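/- **Setting.** An instance consists of $n_1$ people, a finite set $\mathcal B$ of items, for every person $a$ a strict preference list of (distinct) items, and a cost $\mathsf{cost}(b)\ge 0$ (a real number) for every item $b$. Making $x(b)\ge 0$ extra copies of each item $b$ gives the bipartite graph $H_x$ with $x(b)+1$ copies of $b$, in which each person is adjacent to all copies of the items on her list; copies of one item are equally good to everybody. A person prefers a matching $M$ to a matching $M'$ if she is matched in $M$ and not in $M'$, or is matched in both and ranks her item in $M$ higher. A matching is popular if there is no matching $M'$ such that more people prefer $M'$ to $M$ than prefer $M$ to $M'$. The min-cost augmentation problem asks for an $x$ of minimum total cost $\sum_b x(b)\,\mathsf{cost}(b)$ such that $H_x$ admits a popular matching. Append to the end of the list of each person $a$ a last item $\ell_a$, which is adjacent to $a$ only. Let $H_x^1$ be the resulting graph restricted to top-ranked edges. With respect to a matching, a vertex is called even (odd) if it is reached from an unmatched vertex by an alternating path of even (odd) length; for maximum matchings this does not depend on the matching. Let $f(a)$ be the set of the top-ranked posts of $a$ (all copies of her first item, or $\ell_a$ if her list is empty), let $s(a)$ be the set of her most preferred posts among those that are even in $H_x^1$ with respect to a maximum matching, and let $H_x'$ be the graph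 with the edges $(a,p)$, $p\in f(a)\cup s(a)$. The greedy algorithm starts with $x=0$. While a maximum matching $M$ of $H_x'$ leaves some person unmatched, it adds one copy of a cheapest item of $\mathcal B$ that is odd in $H_x'$ with respect to $M$; then it recomputes $H_x'$. It outputs $x$ when $H_x'$ has a matching that matches all people. **Theorem.** Suppose that every person has a strict preference list of length at most $2$. 1. Whatever maximum matchings are used and however ties between cheapest items are broken, the greedy algorithm never gets stuck (an odd item exists as long as $H_x'$ has no matching of all people), stops after at most $n_1$ iterations, and outputs an optimal solution of the min-cost augmentation problem. 2. The min-cost augmentation problem can be solved in $O(n_1^2)$ time: there are a single program and a constant $C$ such that on every such instance the program halts after at most $C(n_1^2+1)$ steps with an optimal solution $x$, which is moreover an output of the greedy algorithm. Here programs run on a unit-cost random access machine on natural numbers, whose memory is initially zero except for the input, with indirect addressing, increment, decrement and tests $=,<$ on registers, whose only access to the real costs is a test whether one given item is cheaper than another. -/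

import Mathlib

/-! ## Matchings and alternating paths in bipartite graphs -/

namespace PopAug

section Bipartite

variable {α β : Type}

/-- `M` is a matching of the bipartite graph with edge relation `E ⊆ α × β`:
`M a = some x` says that `(a, x)` is an edge of `M`, `M a = none` that `a` is unmatched. -/
def IsMatching (E : α → β → Prop) (M : α → Option β) : Prop :=
  (∀ a x, M a = some x → E a x) ∧
  (∀ a a' x, M a = some x → M a' = some x → a = a')

/-- The number of edges of a matching. -/
noncomputable def size (M : α → Option β) : ℕ := {a | M a ≠ none}.ncard

/-- Maximum cardinality matchings. -/
def IsMaxMatching (E : α → β → Prop) (M : α → Option β) : Prop :=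
  IsMatching E M ∧ ∀ M', IsMatching E M' → size M' ≤ size M

/-- Matchings that match every vertex on the left side. -/
def IsComplete (M : α → Option β) : Prop := ∀ a, M a ≠ none

/-- Adjacency in the graph with edge relation `E`, as a symmetric relation on all vertices. -/
def Adj (E : α → β → Prop) : α ⊕ β → α ⊕ β → Prop
  | .inl a, .inr x => E a x
  | .inr x, .inl a => E a x
  | _, _ => False

/-- The edges of `M`, as a symmetric relation on all vertices. -/
def MatchedTo (M : α → Option β) : α ⊕ β → α ⊕ β → Prop :=
  Adj fun a x => M a = some x

/-- `AltReach E M k v`: some alternating path of length `k` (with respect to `M`) leads from an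
unmatched vertex to `v`. Its edges are alternately outside `M` and in `M`, starting outside `M`.
(Vertices may repeat; as the graph is bipartite, they only repeat at equal parity, and cutting
out the closed parts leaves an alternating simple path whose length has the same parity.) -/
inductive AltReach (E : α → β → Prop) (M : α → Option β) : ℕ → α ⊕ β → Prop
  | start {v} : (∀ u, ¬ MatchedTo M v u) → AltReach E M 0 v
  | outside {k u v} : AltReach E M k u → Even k → Adj E u v → ¬ MatchedTo M u v →
      AltReach E M (k + 1) v
  | inside {k u v} : AltReach E M k u → Odd k → MatchedTo M u v → AltReach E M (k + 1) v

/-- `v` is even with respect to the matching `M`. -/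
def EvenWrt (E : α → β → Prop) (M : α → Option β) (v : α ⊕ β) : Prop :=
  ∃ k, Even k ∧ AltReach E M k v

/-- `v` is odd with respect to the matching `M`. -/
def OddWrt (E : α → β → Prop) (M : α → Option β) (v : α ⊕ β) : Prop :=
  ∃ k, Odd k ∧ AltReach E M k v

/-- `v` is even (non-critical) in the graph, i.e. with respect to a maximum matching;
which maximum matching is taken does not matter (Gallai-Edmonds). -/
def IsEvenIn (E : α → β → Prop) (v : α ⊕ β) : Prop :=
  ∃ M, IsMaxMatching E M ∧ EvenWrt E M v

end Bipartite

/-! ## Popular matchings and augmentation -/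

/-- An instance with `n` people and `m` items: person `a` has the strict preference list
`pref a` (most preferred item first), and a new copy of item `b` costs `cost b ≥ 0`. -/
structure Instance where
  n : ℕ
  m : ℕ
  pref : Fin n → List (Fin m)
  strict : ∀ a, (pref a).Nodup
  cost : Fin m → ℝ
  cost_nonneg : ∀ b, 0 ≤ cost b

namespace Instance

variable (I : Instance)

/-- The item vertices after making `x b` extra copies of each item `b`:
there are `x b + 1` copies of `b`. -/
abbrev Copy (x : Fin I.m → ℕ) : Type := Σ b : Fin I.m, Fin (x b + 1)

/-- The augmented graph: a person is adjacent to all the copies of the items on her list. -/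
def graph (x : Fin I.m → ℕ) (a : Fin I.n) (p : I.Copy x) : Prop := p.1 ∈ I.pref a

/-- Person `a` strictly prefers the outcome `p` to the outcome `q` (`none`: unmatched);
copies of the same item are equally good. -/
def Prefers {x : Fin I.m → ℕ} (a : Fin I.n) : Option (I.Copy x) → Option (I.Copy x) → Prop
  | some _, none => True
  | some p, some q => (I.pref a).idxOf p.1 < (I.pref a).idxOf q.1
  | none, _ => False

/-- The number of people who prefer `M` to `M'`. -/
noncomputable def votes {x : Fin I.m → ℕ} (M M' : Fin I.n → Option (I.Copy x)) : ℕ :=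
  {a | I.Prefers a (M a) (M' a)}.ncard

/-- `M` is a popular matching of the graph augmented by `x`: no matching is more popular. -/
def IsPopular (x : Fin I.m → ℕ) (M : Fin I.n → Option (I.Copy x)) : Prop :=
  IsMatching (I.graph x) M ∧
  ¬ ∃ M', IsMatching (I.graph x) M' ∧ I.votes M M' < I.votes M' M

/-- The total cost of making `x b` extra copies of each item `b`. -/
noncomputable def totalCost (x : Fin I.m → ℕ) : ℝ := ∑ b, (x b : ℝ) * I.cost b

/-- `x` solves the min-cost augmentation problem: the graph augmented by `x` admits a popular
matching, and no cheaper augmentation does. -/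
def IsMinCostAugmentation (x : Fin I.m → ℕ) : Prop :=
  (∃ M, I.IsPopular x M) ∧ ∀ y, (∃ M, I.IsPopular y M) → I.totalCost x ≤ I.totalCost y

/-! ## The graph of `f`- and `s`-edges and the greedy algorithm -/

/-- Items (with copies) and last items: `Sum.inr a` is the last item of person `a`. -/
abbrev Post (x : Fin I.m → ℕ) : Type := I.Copy x ⊕ Fin I.n

/-- The augmented graph in which each person's list is extended by her own last item. -/
def extGraph (x : Fin I.m → ℕ) (a : Fin I.n) : I.Post x → Prop
  | .inl p => I.graph x a p
  | .inr a' => a' = a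

/-- The rank, counted from `0`, of a post on the extended list of `a`. -/
def rank {x : Fin I.m → ℕ} (a : Fin I.n) : I.Post x → ℕ
  | .inl p => (I.pref a).idxOf p.1
  | .inr _ => (I.pref a).length

/-- The graph of the top-ranked edges. It is also the graph of the edges `(a, p)`, `p ∈ f(a)`. -/
def topGraph (x : Fin I.m → ℕ) (a : Fin I.n) (p : I.Post x) : Prop :=
  I.extGraph x a p ∧ I.rank a p = 0

/-- `p ∈ s(a)`: `p` is a most preferred post of `a` among those even in the top-ranked graph. -/
def IsSPost (x : Fin I.m → ℕ) (a : Fin I.n) (p : I.Post x) : Prop :=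
  I.extGraph x a p ∧ IsEvenIn (I.topGraph x) (.inr p) ∧
  ∀ q, I.extGraph x a q → IsEvenIn (I.topGraph x) (.inr q) → I.rank a p ≤ I.rank a q

/-- The graph with the edges `(a, p)`, `p ∈ f(a) ∪ s(a)`. -/
def fsGraph (x : Fin I.m → ℕ) (a : Fin I.n) (p : I.Post x) : Prop :=
  I.topGraph x a p ∨ I.IsSPost x a p

/-- Item `b` (one of its copies) is odd in the graph of `f`- and `s`-edges, w.r.t. `M`. -/
def OddItem (x : Fin I.m → ℕ) (M : Fin I.n → Option (I.Post x)) (b : Fin I.m) : Prop :=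
  ∃ i, OddWrt (I.fsGraph x) M (.inr (.inl ⟨b, i⟩))

/-- One iteration of the greedy algorithm: a maximum matching `M` of the current graph of
`f`- and `s`-edges is not complete, and a copy of a cheapest odd item is added. -/
def GreedyStep (x y : Fin I.m → ℕ) : Prop :=
  ∃ M b, IsMaxMatching (I.fsGraph x) M ∧ ¬ IsComplete M ∧
    I.OddItem x M b ∧ (∀ b', I.OddItem x M b' → I.cost b ≤ I.cost b') ∧
    y = Function.update x b (x b + 1)

/-- The numbers of extra copies that can be present after `k` iterations, whatever maximum
matchings are used and however ties between cheapest items are broken. -/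
inductive GreedyReach : ℕ → (Fin I.m → ℕ) → Prop
  | start : GreedyReach 0 (fun _ => 0)
  | step {k x y} : GreedyReach k x → I.GreedyStep x y → GreedyReach (k + 1) y

/-- The stopping test of the greedy algorithm: the graph of `f`- and `s`-edges has a matching
that matches every person. -/
def Done (x : Fin I.m → ℕ) : Prop := ∃ M, IsMatching (I.fsGraph x) M ∧ IsComplete M

end Instance

/-! ## The machine

A random access machine with registers and arrays that hold natural numbers, indirect addressing
into the arrays, increment and decrement as its only arithmetic, and structured control flow.
A register or cell grows by at most one per step, so no computation can be hidden in
large numbers. The real costs sit in a read-only array and can only be compared. -/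

/-- Tests on registers `i`, `j`. -/
inductive Test
  | eq (i j : ℕ)
  | lt (i j : ℕ)
  /-- compares the costs of the items whose indices are in registers `i` and `j` -/
  | costLt (i j : ℕ)

/-- Programs. All arguments are register names, except `k` (a constant) and
`t` (the name of an array). -/
inductive Prog
  | const (i k : ℕ)
  | copy (i j : ℕ)
  | inc (i : ℕ)
  | dec (i : ℕ)
  /-- register `i` := array `t` at the index given by register `j` -/
  | load (i t j : ℕ)
  /-- array `t` at the index given by register `i` := register `j` -/
  | store (t i j : ℕ)
  | seq (p q : Prog)
  | ite (c : Test) (p q : Prog)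
  | while (c : Test) (p : Prog)

/-- Memory: the registers and the arrays. -/
structure Mem where
  reg : ℕ → ℕ
  arr : ℕ → ℕ → ℕ

/-- Assignment to a register. -/
def Mem.setReg (s : Mem) (i v : ℕ) : Mem := { s with reg := Function.update s.reg i v }

/-- Assignment to an array cell. -/
def Mem.setArr (s : Mem) (t i v : ℕ) : Mem :=
  { s with arr := Function.update s.arr t (Function.update (s.arr t) i v) }

/-- The outcome of a test. -/
def Test.Holds (cost : ℕ → ℝ) (s : Mem) : Test → Prop
  | .eq i j => s.reg i = s.reg j
  | .lt i j => s.reg i < s.reg j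
  | .costLt i j => cost (s.reg i) < cost (s.reg j)

/-- `Run cost p s t s'`: started in `s`, the program `p` halts in `s'` after exactly `t` steps,
where each assignment and each evaluation of a test is one step. The rules are deterministic:
`s` determines `t` and `s'`, and they exist exactly if the program halts. -/
inductive Run (cost : ℕ → ℝ) : Prog → Mem → ℕ → Mem → Prop
  | const {i k s} : Run cost (.const i k) s 1 (s.setReg i k)
  | copy {i j s} : Run cost (.copy i j) s 1 (s.setReg i (s.reg j))
  | inc {i s} : Run cost (.inc i) s 1 (s.setReg i (s.reg i + 1))
  | dec {i s} : Run cost (.dec i) s 1 (s.setReg i (s.reg i - 1))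
  | load {i t j s} : Run cost (.load i t j) s 1 (s.setReg i (s.arr t (s.reg j)))
  | store {t i j s} : Run cost (.store t i j) s 1 (s.setArr t (s.reg i) (s.reg j))
  | seq {p q s s' s'' t t'} : Run cost p s t s' → Run cost q s' t' s'' →
      Run cost (.seq p q) s (t + t') s''
  | iteTrue {c p q s t s'} : c.Holds cost s → Run cost p s t s' →
      Run cost (.ite c p q) s (t + 1) s'
  | iteFalse {c p q s t s'} : ¬ c.Holds cost s → Run cost q s t s' →
      Run cost (.ite c p q) s (t + 1) s'
  | whileTrue {c p s s' s'' t t'} : c.Holds cost s → Run cost p s t s' →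
      Run cost (.while c p) s' t' s'' → Run cost (.while c p) s (t + t' + 1) s''
  | whileFalse {c p s} : ¬ c.Holds cost s → Run cost (.while c p) s 1 s

namespace Instance

variable (I : Instance)

/-- The cost array of an instance. -/
noncomputable def costArray (b : ℕ) : ℝ := if h : b < I.m then I.cost ⟨b, h⟩ else 0

/-- The `j`-th item (from `0`) on the list of person `a`; `0` if there is none. -/
def choice (j a : ℕ) : ℕ :=
  if h : a < I.n then (((I.pref ⟨a, h⟩)[j]?).map Fin.val).getD 0 else 0

/-- The length of the list of person `a`. -/
def listLength (a : ℕ) : ℕ := if h : a < I.n then (I.pref ⟨a, h⟩).length else 0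

/-- The memory at the start, for lists of length at most 2: the numbers of people and of items
in registers 0 and 1, the lengths of the lists in array 0, the first choices in array 1, the
second choices in array 2, and zeros elsewhere. -/
def input : Mem where
  reg
    | 0 => I.n
    | 1 => I.m
    | _ => 0
  arr
    | 0 => I.listLength
    | 1 => I.choice 0
    | 2 => I.choice 1
    | _ => fun _ => 0

/-- The result: array 3 holds the number of extra copies of each item. -/
def output (s : Mem) (b : Fin I.m) : ℕ := s.arr 3 b

end Instance

end PopAug

/-! Only the hard persons matter: those with two choices, the second of which is nobody's first. An
unmatched hard person could take a copy of her second choice; its holder, if any, would move up to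
her own first choice and evict at most one person. So popular matchings match all hard persons
(`IsPopular.feas`), and `y` must be feasible in the sense of `Feas`: with hard persons as edges
between items, every edge can be assigned to one of its ends so that item `b` receives at most `y b
+ 1` edges.

The converse holds when `x` is `Tame`, that is, no first choice has more copies than people who rank
it first. Then the even items of the top-ranked graph are exactly those that are nobody's first
choice, the `f`- and `s`-edges of a hard person lead to her two items, and everybody else has her
private last item (`Tame.fsGraph_of_hard`, `Tame.fsGraph_of_not_hard`). Feasibility is therefore the
stopping test (`Tame.feas_iff_done`), and it yields a popular matching that uses all copies of first
choices (`Tame.exists_isPopular`).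

The odd items are the items of the hard persons reached by alternating walks from unmatched persons,
and adding a copy of one preserves tameness (`Tame.add_oddItem`). By `Tame.exchange`, a feasible `y
≥ x` stays feasible when a surplus copy of some odd item is traded for a copy of a given odd item
`b`. For a cheapest `b` this does not raise the cost, so the greedy vector always lies below a
feasible vector that has the same number of copies as any prescribed one and costs no more
(`GreedyReach.inv`). Optimality and the bound on the iterations follow.

The quadratic program computes no matchings; it imitates Kruskal's algorithm. The edges are
processed by decreasing cost of their cheaper end and accepted as long as every class of items,
joined by accepted edges, contains at most one cycle. A class with a cycle is full. An edge with
both ends in full classes is rejected and pays for a copy of its cheaper end. The accepted edges of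
the full classes already use one copy of each of their items, so any feasible vector needs as many
extra copies there as there are rejected edges (`KruskalInv.card_le`). This gives the certificates
`Certified`, and the exchange property turns a certified feasible vector into a greedy output
(`GreedyReach.of_certified`). Each of the `n` rounds consists of one search and at most one
relabelling, both in passes over the people. -/

namespace PopAug

/-! ### Alternating walks and augmentation -/

section Reach

variable {α β : Type}

/-- `PReach E M k a`: the person `a` is the end of an alternating walk with `k` edges of `M`
that starts in an unmatched person. -/
inductive PReach (E : α → β → Prop) (M : α → Option β) : ℕ → α → Prop
  | start {a} : M a = none → PReach E M 0 a
  | step {k a p a'} : PReach E M k a → E a p → M a' = some p → PReach E M (k + 1) a'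

/-- The persons reached from unmatched persons by alternating walks. -/
def Reach (E : α → β → Prop) (M : α → Option β) (a : α) : Prop := ∃ k, PReach E M k a

/-- Walks counted by their matching edges are alternating walks of even length, and one more edge
leads to an odd post. This and `AltReach.reach` replace the parity bookkeeping by `Reach`. -/
theorem PReach.evenWrt {E : α → β → Prop} {M : α → Option β} {k : ℕ} {a : α}
    (h : PReach E M k a) :
    EvenWrt E M (.inl a) ∧ ∀ p, E a p → OddWrt E M (.inr p) := by
  induction h with
  | @start a h0 =>
    have h1 : AltReach E M 0 (.inl a) := by
      refine .start fun u => ?_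
      cases u with
      | inl _ => exact id
      | inr x => simp [MatchedTo, Adj, h0]
    refine ⟨⟨0, by simp, h1⟩, fun p hp => ⟨1, by simp, .outside h1 (by simp) hp ?_⟩⟩
    simp [MatchedTo, Adj, h0]
  | @step k a p a' _ he hm ih =>
    obtain ⟨j, hj, hr⟩ := ih.2 p he
    have h1 : AltReach E M (j + 1) (.inl a') := .inside hr hj hm
    refine ⟨⟨j + 1, hj.add_one, h1⟩, fun q hq => ?_⟩
    -- The edge to `q` may be the matching edge just traversed; then `q` is the post through which
    -- `a'` was entered, and it is odd already.
    by_cases hqa : M a' = some q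
    · rw [hm] at hqa
      cases hqa
      exact ⟨j, hj, hr⟩
    · exact ⟨j + 1 + 1, hj.add_one.add_one, .outside h1 hj.add_one hq hqa⟩

/-- By bipartiteness, persons at even length and posts at odd length can only come from walks that
start in unmatched persons, not in unmatched posts. -/
theorem AltReach.reach {E : α → β → Prop} {M : α → Option β} {k : ℕ} {v : α ⊕ β}
    (h : AltReach E M k v) :
    (∀ a, v = .inl a → Even k → Reach E M a) ∧
      (∀ p, v = .inr p → Odd k → ∃ a, Reach E M a ∧ E a p) := by
  induction h with
  | start h0 =>
    refine ⟨?_, fun p _ h => by simp at h⟩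
    rintro a rfl -
    refine ⟨0, .start ?_⟩
    cases hM : M a with
    | none => rfl
    | some x => exact absurd hM (h0 (.inr x))
  | @outside k u v _ hk hadj _ ih =>
    refine ⟨fun a _ h => absurd h (Nat.not_even_iff_odd.2 hk.add_one), ?_⟩
    rintro p rfl -
    cases u with
    | inl a => exact ⟨a, ih.1 a rfl hk, hadj⟩
    | inr q => exact hadj.elim
  | @inside k u v _ hk hm ih =>
    refine ⟨?_, fun a _ h => absurd h (Nat.not_odd_iff_even.2 hk.add_one)⟩
    rintro a rfl -
    cases u with
    | inl _ => exact hm.elim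
    | inr q =>
      obtain ⟨c, ⟨j, hj⟩, hc⟩ := ih.2 q rfl hk
      exact ⟨j + 1, .step hj hc hm⟩

theorem oddWrt_post_iff {E : α → β → Prop} {M : α → Option β} {p : β} :
    OddWrt E M (.inr p) ↔ ∃ a, Reach E M a ∧ E a p :=
  ⟨fun ⟨_, hk, h⟩ => h.reach.2 p rfl hk, fun ⟨_, ⟨_, h⟩, hp⟩ => h.evenWrt.2 p hp⟩

theorem IsMatching.update [DecidableEq α] {E : α → β → Prop} {M : α → Option β}
    (hM : IsMatching E M) {a : α} {p : β} (hE : E a p) (hp : ∀ c, M c ≠ some p) :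
    IsMatching E (Function.update M a (some p)) := by
  refine ⟨fun c q h => ?_, fun c c' q h h' => ?_⟩
  · by_cases hc : c = a
    · subst hc; simp at h; subst h; exact hE
    · simp [hc] at h; exact hM.1 _ _ h
  · by_cases hc : c = a <;> by_cases hc' : c' = a
    · rw [hc, hc']
    · subst hc; simp [hc'] at h h'; subst h; exact absurd h' (hp _)
    · subst hc'; simp [hc] at h h'; subst h'; exact absurd h (hp _)
    · simp [hc, hc'] at h h'; exact hM.2 _ _ _ h h'

/-- Reassigning `a` can spoil a walk only where it visits `a`, and then `a` is reached by an initial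
piece of that walk. -/
theorem PReach.update_or [DecidableEq α] {E : α → β → Prop} {M : α → Option β} {a : α} {p : β}
    {k : ℕ} {c : α} (h : PReach E M k c) :
    (∃ i ≤ k, PReach E M i a) ∨ PReach E (Function.update M a (some p)) k c := by
  induction h with
  | @start c h0 =>
    by_cases hc : c = a
    · subst hc; exact .inl ⟨0, le_rfl, .start h0⟩
    · exact .inr (.start (by simp [hc, h0]))
  | @step k c q c' h he hm ih =>
    rcases ih with ⟨i, hi, h1⟩ | h1
    · exact .inl ⟨i, by omega, h1⟩
    · by_cases hc : c' = a
      · subst hc; exact .inl ⟨k + 1, le_rfl, .step h he hm⟩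
      · exact .inr (.step h1 he (by simp [hc, hm]))

/-- Walks for the new matching differ from old ones only where they pass through `a`, and there they
can be restarted because `a` is reached in the old matching. -/
theorem Reach.of_update [DecidableEq α] {E : α → β → Prop} {M : α → Option β} {a : α} {p : β}
    (ha : Reach E M a) {c : α} (h : Reach E (Function.update M a (some p)) c) :
    Reach E M c := by
  obtain ⟨k, h⟩ := h
  induction h with
  | @start c h0 =>
    by_cases hc : c = a
    · rwa [hc]
    · exact ⟨0, .start (by simpa [hc] using h0)⟩
  | @step k c q c' _ he hm ih =>
    by_cases hc : c' = a
    · rwa [hc]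
    · obtain ⟨j, hj⟩ := ih
      exact ⟨j + 1, .step hj he (by simpa [hc] using hm)⟩

/-- Augmentation: if a free post is adjacent to a reached person, then some matching covers this
post and all the posts and persons covered before, and one more person; only the posts of
reached persons change. -/
theorem IsMatching.augment [DecidableEq α] {E : α → β → Prop} {p : β} {a : α} {k : ℕ}
    {M : α → Option β} (hM : IsMatching E M) (ha : PReach E M k a) (hE : E a p)
    (hp : ∀ c, M c ≠ some p) :
    ∃ M', IsMatching E M' ∧ (∀ q, (q = p ∨ ∃ c, M c = some q) → ∃ c, M' c = some q) ∧
      (∀ c, M' c = M c ∨ Reach E M c) ∧ (∀ c, M c ≠ none → M' c ≠ none) ∧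
      ∃ c, M c = none ∧ M' c ≠ none := by
  induction k using Nat.strong_induction_on generalizing M a p with
  | _ k ih =>
    have hM2 := hM.update hE hp
    have hsame : ∀ c, Function.update M a (some p) c = M c ∨ Reach E M c := by
      intro c
      by_cases hc : c = a
      · subst hc; exact .inr ⟨k, ha⟩
      · exact .inl (by simp [hc])
    cases ha with
    | start h0 =>
      refine ⟨_, hM2, ?_, hsame, ?_, a, h0, by simp⟩
      · rintro q (rfl | ⟨c, hc⟩)
        · exact ⟨a, by simp⟩
        · have : c ≠ a := by rintro rfl; rw [h0] at hc; cases hc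
          exact ⟨c, by simp [this, hc]⟩
      · intro c hc
        by_cases hca : c = a <;> simp [hca, hc]
    | @step j c q _ h he hm =>
      have hra : Reach E M a := ⟨j + 1, .step h he hm⟩
      -- Give `p` to `a`, which frees her old post `q` next to her predecessor. If the walk to the
      -- predecessor avoids `a`, it survives this change and is shorter; otherwise `a` herself has a
      -- shorter walk in the old matching.
      rcases h.update_or (a := a) (p := p) with ⟨i, hi, h1⟩ | h1
      · exact ih i (by omega) hM h1 hE hp
      · have hq : ∀ c, Function.update M a (some p) c ≠ some q := by
          intro c' hc'
          by_cases hca : c' = a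
          · subst hca; simp at hc'; subst hc'; exact hp _ hm
          · simp [hca] at hc'; exact hca (hM.2 _ _ _ hc' hm)
        obtain ⟨M', g1, g2, g3, g4, c', g5, g6⟩ := ih j (by omega) hM2 h1 he hq
        refine ⟨M', g1, ?_, ?_, ?_, c', ?_, g6⟩
        · rintro r (rfl | ⟨c, hc⟩)
          · exact g2 _ (.inr ⟨a, by simp⟩)
          · by_cases hca : c = a
            · subst hca; rw [hm] at hc; cases hc; exact g2 _ (.inl rfl)
            · exact g2 _ (.inr ⟨c, by simp [hca, hc]⟩)
        · intro c
          rcases g3 c with h | h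
          · rw [h]; exact hsame c
          · exact .inr (hra.of_update h)
        · intro c hc
          refine g4 c ?_
          by_cases hca : c = a <;> simp [hca, hc]
        · by_cases hca : c' = a
          · subst hca; simp at g5
          · simpa [hca] using g5

theorem size_lt_size [Finite α] {M M' : α → Option β} (h : ∀ c, M c ≠ none → M' c ≠ none)
    (h' : ∃ c, M c = none ∧ M' c ≠ none) : size M < size M' := by
  refine Set.ncard_lt_ncard ⟨fun c hc => h c hc, fun hs => ?_⟩ (Set.toFinite _)
  obtain ⟨c, h1, h2⟩ := h'
  exact hs h2 h1

/-- A free post next to a reached person would allow an augmentation, and the holder of a matched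
one is reached by prolonging the walk. -/
theorem IsMaxMatching.matched_of_reach [Finite α] {E : α → β → Prop} {M : α → Option β}
    (hM : IsMaxMatching E M) {a : α} {p : β} (ha : Reach E M a) (hE : E a p) :
    ∃ c, M c = some p ∧ Reach E M c := by
  classical
  obtain ⟨k, hk⟩ := ha
  by_contra! hcon
  by_cases hp : ∃ c, M c = some p
  · obtain ⟨c, hc⟩ := hp
    exact hcon c hc ⟨k + 1, .step hk hE hc⟩
  · push Not at hp
    obtain ⟨M', h1, -, -, h4, h5⟩ := hM.1.augment hk hE hp
    exact absurd (hM.2 M' h1) (not_le.2 (size_lt_size h4 h5))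

theorem exists_isMaxMatching [Finite α] (E : α → β → Prop) : ∃ M, IsMaxMatching E M := by
  let S : Set ℕ := {k | ∃ M, IsMatching E M ∧ size M = k}
  have hne : S.Nonempty := ⟨_, fun _ => none, ⟨by simp, by simp⟩, rfl⟩
  have hbd : BddAbove S := by
    refine ⟨Nat.card α, ?_⟩
    rintro _ ⟨M, -, rfl⟩
    exact Set.ncard_le_card _
  obtain ⟨M, hM, hs⟩ := Nat.sSup_mem hne hbd
  exact ⟨M, hM, fun M' hM' => hs ▸ le_csSup hbd ⟨M', hM', rfl⟩⟩

end Reach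

/-! ### Assignments of edges to their ends, and exchange -/

section Assignments

variable {α ι : Type} [Fintype α] [DecidableEq ι]

/-- With `y b + 1` copies of every item `b`, each `a : α` can get a copy of `u a` or of `v a`. -/
def Feas (u v : α → ι) (y : ι → ℕ) : Prop :=
  ∃ g : α → ι, (∀ a, g a = u a ∨ g a = v a) ∧ ∀ b, (Finset.univ.filter (g · = b)).card ≤ y b + 1

theorem card_filter_update [DecidableEq α] (g : α → ι) (a : α) (c d : ι) :
    (Finset.univ.filter (Function.update g a c · = d)).card + (Pi.single (g a) 1 : ι → ℕ) d =
      (Finset.univ.filter (g · = d)).card + (Pi.single c 1 : ι → ℕ) d := by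
  simp only [Finset.card_filter]
  rw [← Finset.add_sum_erase _ _ (Finset.mem_univ a),
    ← Finset.add_sum_erase _ (fun i => if g i = d then 1 else 0) (Finset.mem_univ a)]
  have : ∀ i ∈ Finset.univ.erase a, (if Function.update g a c i = d then 1 else 0) =
      if g i = d then 1 else 0 := fun i hi => by
    rw [Function.update_of_ne (Finset.ne_of_mem_erase hi)]
  rw [Finset.sum_congr rfl this]
  simp only [Function.update_self, Pi.single_apply]
  grind

/-- Exchange: `R` is a set of persons, `RI` contains their items, and `h` gives to the persons
of `R` at least `x c + 1` copies of each item `c` of `RI`, and one more of the item `b`. Then a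
feasible `y ≥ x` remains feasible when a copy of some `c ∈ RI` with `x c < y c` is traded
for one of `b`. -/
theorem Feas.exchange {u v : α → ι} {x y : ι → ℕ} (hy : Feas u v y) (hxy : x ≤ y)
    {R : Set α} [DecidablePred (· ∈ R)] {RI : Set ι} (hR : ∀ a ∈ R, u a ∈ RI ∧ v a ∈ RI)
    {h : α → ι} (hh : ∀ a, h a = u a ∨ h a = v a) {b : ι} (hb : b ∈ RI)
    (hcnt : ∀ c ∈ RI, x c + 1 + (Pi.single b 1 : ι → ℕ) c ≤
      (Finset.univ.filter fun a => a ∈ R ∧ h a = c).card) :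
    ∃ y' c, c ∈ RI ∧ x c < y c ∧ Feas u v y' ∧ y' + Pi.single c 1 = y + Pi.single b 1 := by
  classical
  -- The assignment `g` respects `y` with one more copy of `b`, and leaves a copy of `c` unused. At
  -- the start `c = b`; the free copy then moves through `RI`, while `g` disagrees with `h` in fewer
  -- and fewer places.
  have key : ∀ (k : ℕ) (g : α → ι) (c : ι), (Finset.univ.filter fun a => g a ≠ h a).card = k →
      c ∈ RI → (∀ a, g a = u a ∨ g a = v a) →
      (∀ d, (Finset.univ.filter (g · = d)).card + (Pi.single c 1 : ι → ℕ) d ≤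
        y d + 1 + (Pi.single b 1 : ι → ℕ) d) →
      ∃ y' c, c ∈ RI ∧ x c < y c ∧ Feas u v y' ∧ y' + Pi.single c 1 = y + Pi.single b 1 := by
    intro k
    induction k using Nat.strong_induction_on with
    | _ k ih =>
      intro g c hk hc hg hgc
      by_cases hlt : x c < y c
      · have h1 : (fun d => y d + (Pi.single b 1 : ι → ℕ) d - (Pi.single c 1 : ι → ℕ) d) +
            Pi.single c 1 = y + Pi.single b 1 := by
          funext d
          simp only [Pi.add_apply, Pi.single_apply]
          grind
        refine ⟨_, c, hc, hlt, ⟨g, hg, fun d => ?_⟩, h1⟩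
        have := congrFun h1 d
        have h2 := hgc d
        simp only [Pi.add_apply] at this
        omega
      · have hyc : y c = x c := le_antisymm (not_lt.1 hlt) (hxy c)
        have h1 := hgc c
        have h2 := hcnt c hc
        rw [Pi.single_eq_same] at h1
        -- Without surplus at `c`, the assignment `h` gives `c` to more persons of `R` than `g`
        -- gives it to in total. Some person of `R` can thus move to `c` as in `h`, and the copy she
        -- gives up belongs to an item of `RI`.
        have : ¬ (Finset.univ.filter fun a => a ∈ R ∧ h a = c) ⊆ Finset.univ.filter (g · = c) :=
          fun hs => by
            have := Finset.card_le_card hs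
            omega
        obtain ⟨a, ha, hga⟩ := Finset.not_subset.1 this
        simp only [Finset.mem_filter, Finset.mem_univ, true_and] at ha hga
        have hc2 : g a ∈ RI := by
          rcases hg a with e | e <;> rw [e]
          · exact (hR a ha.1).1
          · exact (hR a ha.1).2
        refine ih _ ?_ (Function.update g a c) (g a) rfl hc2 ?_ ?_
        · rw [← hk]
          refine Finset.card_lt_card ⟨fun i hi => ?_, fun hs => ?_⟩
          · simp only [Finset.mem_filter, Finset.mem_univ, true_and] at hi ⊢
            by_cases hia : i = a
            · subst hia; rw [ha.2]; exact hga
            · rwa [Function.update_of_ne hia] at hi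
          · have := hs (show a ∈ _ by simp [ha.2, hga])
            simp [ha.2] at this
        · intro i
          by_cases hia : i = a
          · subst hia; rw [Function.update_self, ← ha.2]; exact hh i
          · rw [Function.update_of_ne hia]; exact hg i
        · intro d
          have := card_filter_update g a c d
          have := hgc d
          omega
  obtain ⟨g, hg, hgc⟩ := hy
  exact key _ g b rfl hb hg fun d => Nat.add_le_add_right (hgc d) _

end Assignments

/-! ### Kruskal's algorithm for graphs with at most one cycle in each component -/

section Kruskal

variable {α ι : Type}

/-- The end points of the edges `(u a, v a)`. -/
def endpoints (u v : α → ι) : Set ι := {b | ∃ a, b = u a ∨ b = v a}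

/-- `Z` contains exactly one vertex of every class that is not full, and no other vertices. The
classes are those of the labelling `lab` of `V`. -/
structure IsTransversal (V : Set ι) (lab : ι → ℕ) (full : ℕ → Prop) (Z : Set ι) : Prop where
  sub : Z ⊆ V
  free : ∀ z ∈ Z, ¬ full (lab z)
  hit : ∀ b ∈ V, ¬ full (lab b) → ∃ z ∈ Z, lab z = lab b
  inj : ∀ z ∈ Z, ∀ z' ∈ Z, lab z = lab z' → z = z'

theorem exists_isTransversal (V : Set ι) (lab : ι → ℕ) (full : ℕ → Prop) :
    ∃ Z, IsTransversal V lab full Z := by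
  classical
  let L : Set ℕ := {l | ¬ full l ∧ ∃ b ∈ V, lab b = l}
  have hL : ∀ l : L, ∃ b ∈ V, lab b = l := fun l => l.2.2
  choose r hr hlab using hL
  refine ⟨Set.range r, ?_, ?_, ?_, ?_⟩
  · rintro _ ⟨l, rfl⟩; exact hr l
  · rintro _ ⟨l, rfl⟩; rw [hlab]; exact l.2.1
  · intro b hb hf
    exact ⟨_, ⟨⟨lab b, hf, b, hb, rfl⟩, rfl⟩, hlab _⟩
  · rintro _ ⟨l, rfl⟩ _ ⟨l', rfl⟩ h
    rw [hlab, hlab] at h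
    rw [Subtype.ext h]

/-- Merging the classes of `p` and `q`, not both of which are full. -/
theorem IsTransversal.of_merge {V : Set ι} {lab lab' : ι → ℕ} {full full' : ℕ → Prop}
    {Z : Set ι} {p q : ι} (hp : p ∈ V) (hq : q ∈ V) (hfull : ¬ (full (lab p) ∧ full (lab q)))
    (hlab : ∀ b ∈ V, lab' b = if lab b = lab p then lab q else lab b)
    (hfull' : ∀ l, full' l ↔ full l ∨ l = lab q ∧ (lab p = lab q ∨ full (lab p)))
    (hZ : IsTransversal V lab' full' Z) :
    ∃ r, (r = p ∨ r = q) ∧ r ∉ Z ∧ IsTransversal V lab full (insert r Z) := by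
  obtain ⟨h1, h2, h3, h4⟩ := hZ
  have hlp : lab' p = lab q := by rw [hlab p hp, if_pos rfl]
  have hlq : lab' q = lab q := by rw [hlab q hq]; split_ifs <;> rfl
  have hlabZ : ∀ z ∈ Z, lab' z = if lab z = lab p then lab q else lab z :=
    fun z hz => hlab z (h1 hz)
  -- If the merged class is full, `Z` avoids it, and exactly one class that was not full before
  -- disappears into it. The end `r` is taken from that class and represents it.
  by_cases hm : full' (lab q)
  · have hno : ∀ z ∈ Z, lab z ≠ lab p ∧ lab z ≠ lab q := by
      intro z hz
      have := h2 z hz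
      have := hlabZ z hz
      grind
    have hm' := (hfull' (lab q)).1 hm
    have : ∃ r, (r = p ∨ r = q) ∧ ¬ full (lab r) ∧
        ∀ b, (lab b = lab p ∨ lab b = lab q) → ¬ full (lab b) → lab r = lab b := by
      by_cases hfp : full (lab p)
      · exact ⟨q, .inr rfl, fun h => hfull ⟨hfp, h⟩, by grind⟩
      · exact ⟨p, .inl rfl, hfp, by grind⟩
    obtain ⟨r, hr, hrf, hrb⟩ := this
    refine ⟨r, hr, ?_, ?_, ?_, ?_, ?_⟩
    · intro hrZ; have := hno r hrZ; grind
    · rintro z (rfl | hz)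
      · rcases hr with rfl | rfl <;> assumption
      · exact h1 hz
    · rintro z (rfl | hz)
      · exact hrf
      · have := h2 z hz; have := hlabZ z hz; have := hno z hz; have := hfull' (lab' z); grind
    · intro b hb hbf
      by_cases hc : lab b = lab p ∨ lab b = lab q
      · exact ⟨r, Set.mem_insert _ _, hrb b hc hbf⟩
      · have e : lab' b = lab b := by rw [hlab b hb]; grind
        obtain ⟨z, hz, hzb⟩ := h3 b hb (by rw [e, hfull']; grind)
        refine ⟨z, Set.mem_insert_of_mem _ hz, ?_⟩
        have := hlabZ z hz; have := hno z hz; grind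
    · rintro z (rfl | hz) z' (rfl | hz') he
      · rfl
      · have := hno z' hz'; grind
      · have := hno z hz; grind
      · refine h4 z hz z' hz' ?_
        rw [hlabZ z hz, hlabZ z' hz', he]
  · have hm' : ¬ full (lab q) ∧ lab p ≠ lab q ∧ ¬ full (lab p) := by
      have := hfull' (lab q); grind
    obtain ⟨z0, hz0, hz0q⟩ := h3 q hq (by rwa [hlq])
    have hz0c : lab z0 = lab p ∨ lab z0 = lab q := by have := hlabZ z0 hz0; grind
    have huniq : ∀ z ∈ Z, lab z = lab p ∨ lab z = lab q → z = z0 := by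
      intro z hz hc
      refine h4 z hz z0 hz0 ?_
      rw [hz0q, hlq, hlabZ z hz]; grind
    -- Two different classes, neither full, are joined. The representative `z0` of the union lies in
    -- one of them, and `r` is the end of the new edge in the other.
    have : ∃ r, (r = p ∨ r = q) ∧ lab r ≠ lab z0 := by
      rcases hz0c with h | h
      · exact ⟨q, .inr rfl, by rw [h]; exact hm'.2.1.symm⟩
      · exact ⟨p, .inl rfl, by rw [h]; exact hm'.2.1⟩
    obtain ⟨r, hr, hrz⟩ := this
    have hrc : lab r = lab p ∨ lab r = lab q := by grind
    refine ⟨r, hr, ?_, ?_, ?_, ?_, ?_⟩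
    · intro hrZ; have := huniq r hrZ; grind
    · rintro z (rfl | hz)
      · rcases hr with rfl | rfl <;> assumption
      · exact h1 hz
    · rintro z (rfl | hz)
      · grind
      · have := h2 z hz; have := hlabZ z hz; have := hfull' (lab' z); grind
    · intro b hb hbf
      by_cases hc : lab b = lab p ∨ lab b = lab q
      · by_cases hbr : lab r = lab b
        · exact ⟨r, Set.mem_insert _ _, hbr⟩
        · exact ⟨z0, Set.mem_insert_of_mem _ hz0, by grind⟩
      · have e : lab' b = lab b := by rw [hlab b hb]; grind
        obtain ⟨z, hz, hzb⟩ := h3 b hb (by rw [e, hfull']; grind)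
        refine ⟨z, Set.mem_insert_of_mem _ hz, ?_⟩
        have := hlabZ z hz; grind
    · rintro z (rfl | hz) z' (rfl | hz') he
      · rfl
      · have := huniq z' hz'; grind
      · have := huniq z hz; grind
      · refine h4 z hz z' hz' ?_
        rw [hlabZ z hz, hlabZ z' hz', he]

variable [Fintype α] [DecidableEq α] [DecidableEq ι]

/-- `W` certifies that `b` cannot be traded for a cheaper item in `x`. -/
def Certified (u v : α → ι) (cost : ι → ℝ) (x : ι → ℕ) : Prop :=
  ∀ b, 0 < x b → ∃ W : Finset ι, b ∈ W ∧ (∀ c ∈ W, cost b ≤ cost c) ∧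
    ∀ y, Feas u v y → ∑ c ∈ W, x c ≤ ∑ c ∈ W, y c

/-- The invariant of the algorithm that runs through the edges `(u a, v a)` by decreasing cost of
their cheaper end points `w a`. The edges of `A` were accepted; those of `B` were rejected, and
gave rise to the copies `x`. -/
structure KruskalInv (u v w : α → ι) (cost : ι → ℝ) (A B : Finset α) (lab : ι → ℕ)
    (full : ℕ → Prop) (x : ι → ℕ) : Prop where
  bij : ∀ Z, IsTransversal (endpoints u v) lab full Z → ∃ σ : α → ι,
    Set.BijOn σ A (endpoints u v \ Z) ∧ ∀ a, σ a = u a ∨ σ a = v a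
  same : ∀ a ∈ A, lab (u a) = lab (v a)
  disj : Disjoint A B
  full_left : ∀ a ∈ B, full (lab (u a))
  full_right : ∀ a ∈ B, full (lab (v a))
  count : ∀ b, x b = (B.filter (w · = b)).card
  cert : Certified u v cost x
  order : ∀ a ∈ A ∪ B, ∀ a' ∉ A ∪ B, cost (w a') ≤ cost (w a)

variable {u v w : α → ι} {cost : ι → ℝ} {A B : Finset α} {lab lab' : ι → ℕ}
  {full full' : ℕ → Prop} {x x' : ι → ℕ}

/-- All classes are single items that are not full, so a transversal contains every end point and
nothing is left to be covered. -/
theorem KruskalInv.init (hlab : ∀ b ∈ endpoints u v, ∀ c ∈ endpoints u v, lab b = lab c → b = c)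
    (hfull : ∀ l, ¬ full l) (hx : ∀ b, x b = 0) :
    KruskalInv u v w cost ∅ ∅ lab full x := by
  refine ⟨fun Z hZ => ⟨u, ?_, fun _ => .inl rfl⟩, by simp, by simp, by simp, by simp, by simp [hx],
    fun b hb => by simp [hx] at hb, by simp⟩
  have : endpoints u v \ Z = ∅ := by
    refine Set.sdiff_eq_empty.2 fun b hb => ?_
    obtain ⟨z, hz, hzb⟩ := hZ.hit b hb (hfull _)
    rwa [← hlab z (hZ.sub hz) b hb hzb]
  simp [this]

/-- The representatives of the new classes, together with a suitable end `r` of the new edge,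
represent the old classes. The old bijection therefore misses `r`, and the new edge is assigned to
it. -/
theorem KruskalInv.accept (h : KruskalInv u v w cost A B lab full x) {a : α} (ha : a ∉ A ∪ B)
    (hmax : ∀ a' ∉ A ∪ B, cost (w a') ≤ cost (w a))
    (hnf : ¬ (full (lab (u a)) ∧ full (lab (v a))))
    (hlab : ∀ b ∈ endpoints u v, lab' b = if lab b = lab (u a) then lab (v a) else lab b)
    (hfull' : ∀ l, full' l ↔
      full l ∨ l = lab (v a) ∧ (lab (u a) = lab (v a) ∨ full (lab (u a))))
    (hx : ∀ b, x' b = x b) :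
    KruskalInv u v w cost (insert a A) B lab' full' x' := by
  have hu : ∀ c, u c ∈ endpoints u v := fun c => ⟨c, .inl rfl⟩
  have hv : ∀ c, v c ∈ endpoints u v := fun c => ⟨c, .inr rfl⟩
  obtain rfl : x' = x := funext hx
  have hmono : ∀ b ∈ endpoints u v, full (lab b) → full' (lab' b) := by
    intro b hb hf
    rw [hfull', hlab b hb]; grind
  refine ⟨fun Z hZ => ?_, ?_, ?_, ?_, ?_, h.count, h.cert, ?_⟩
  · obtain ⟨r, hr, hrZ, hT⟩ := hZ.of_merge (hu a) (hv a) hnf hlab hfull'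
    obtain ⟨σ, hσ, hσe⟩ := h.bij _ hT
    have haA : a ∉ (A : Set α) := fun haA => ha (Finset.mem_union_left _ haA)
    refine ⟨Function.update σ a r, ?_, ?_⟩
    · have h1 : Set.BijOn (Function.update σ a r) A (endpoints u v \ insert r Z) := by
        refine hσ.congr fun c hc => ?_
        rw [Function.update_of_ne]
        rintro rfl; exact haA hc
      have h2 := h1.insert (a := a) (by simp)
      rw [Function.update_self] at h2
      have h3 : insert r (endpoints u v \ insert r Z) = endpoints u v \ Z := by
        ext b
        have : r ∈ endpoints u v := by rcases hr with rfl | rfl; exacts [hu a, hv a]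
        simp only [Set.mem_insert_iff, Set.mem_sdiff]
        grind
      rw [h3] at h2
      simpa using h2
    · intro c
      by_cases hc : c = a
      · subst hc; simpa using hr
      · simpa [hc] using hσe c
  · intro c hc
    rw [hlab _ (hu c), hlab _ (hv c)]
    rcases Finset.mem_insert.1 hc with rfl | hc
    · grind
    · rw [h.same c hc]
  · rw [Finset.disjoint_insert_left]
    exact ⟨fun haB => ha (Finset.mem_union_right _ haB), h.disj⟩
  · exact fun c hc => hmono _ (hu c) (h.full_left c hc)
  · exact fun c hc => hmono _ (hv c) (h.full_right c hc)
  · intro c hc c' hc'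
    rw [Finset.insert_union] at hc hc'
    rcases Finset.mem_insert.1 hc with rfl | hc
    · exact hmax c' fun h => hc' (Finset.mem_insert_of_mem h)
    · exact h.order c hc c' fun h => hc' (Finset.mem_insert_of_mem h)

/-- The bound behind the optimality: rejected edges lie within the full classes. -/
theorem KruskalInv.card_le [Fintype ι] (h : KruskalInv u v w cost A B lab full x) {a : α}
    (ha : a ∉ A ∪ B) (hau : full (lab (u a))) (hav : full (lab (v a))) [DecidablePred full]
    [DecidablePred (· ∈ endpoints u v)] {y : ι → ℕ} (hy : Feas u v y) :
    (insert a B).card ≤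
      ∑ b ∈ Finset.univ.filter (fun b => b ∈ endpoints u v ∧ full (lab b)), y b := by
  set W := Finset.univ.filter (fun b => b ∈ endpoints u v ∧ full (lab b)) with hW
  have hu : ∀ c, full (lab (u c)) → u c ∈ W := fun c hc => by
    simp only [hW, Finset.mem_filter, Finset.mem_univ, true_and]
    exact ⟨⟨c, .inl rfl⟩, hc⟩
  have hv : ∀ c, full (lab (v c)) → v c ∈ W := fun c hc => by
    simp only [hW, Finset.mem_filter, Finset.mem_univ, true_and]
    exact ⟨⟨c, .inr rfl⟩, hc⟩
  obtain ⟨Z, hZ⟩ := exists_isTransversal (endpoints u v) lab full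
  obtain ⟨σ, hσ, hσe⟩ := h.bij Z hZ
  obtain ⟨g, hg, hgc⟩ := hy
  let A' := A.filter fun c => σ c ∈ W
  -- A transversal contains no item of a full class, so each of these items is covered by an
  -- accepted edge.
  have hA' : W.card ≤ A'.card := by
    refine Finset.card_le_card_of_surjOn σ fun b hb => ?_
    have hb' : b ∈ endpoints u v ∧ full (lab b) := by simpa [hW] using hb
    obtain ⟨c, hc, rfl⟩ := hσ.surjOn ⟨hb'.1, fun hbZ => hZ.free b hbZ hb'.2⟩
    exact ⟨c, by simpa [A'] using ⟨hc, hb⟩, rfl⟩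
  have hdisj : Disjoint A' (insert a B) := by
    rw [Finset.disjoint_insert_right]
    exact ⟨fun h' => ha (Finset.mem_union_left _ (Finset.mem_filter.1 h').1),
      h.disj.mono_left (Finset.filter_subset _ _)⟩
  have hmaps : ∀ c ∈ A' ∪ insert a B, g c ∈ W := by
    intro c hc
    have hfull : full (lab (u c)) ∧ full (lab (v c)) := by
      rcases Finset.mem_union.1 hc with hc | hc
      · obtain ⟨hcA, hcW⟩ := Finset.mem_filter.1 hc
        have h1 : full (lab (σ c)) := by simp only [hW, Finset.mem_filter] at hcW; exact hcW.2.2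
        have h2 := h.same c hcA
        rcases hσe c with e | e <;> rw [e] at h1
        · exact ⟨h1, h2 ▸ h1⟩
        · exact ⟨h2 ▸ h1, h1⟩
      · rcases Finset.mem_insert.1 hc with rfl | hc
        · exact ⟨hau, hav⟩
        · exact ⟨h.full_left c hc, h.full_right c hc⟩
    rcases hg c with e | e <;> rw [e]
    · exact hu c hfull.1
    · exact hv c hfull.2
  -- All these edges have both ends in `W`, so every assignment places them there; the `W.card`
  -- original copies are cancelled against the edges of `A'`.
  have h1 : (A' ∪ insert a B).card ≤ ∑ b ∈ W, (y b + 1) := by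
    rw [Finset.card_eq_sum_card_fiberwise hmaps]
    refine Finset.sum_le_sum fun b _ => le_trans (Finset.card_le_card ?_) (hgc b)
    exact Finset.filter_subset_filter _ (Finset.subset_univ _)
  rw [Finset.card_union_of_disjoint hdisj, Finset.sum_add_distrib, Finset.sum_const,
    smul_eq_mul, mul_one] at h1
  omega

/-- The classes do not change. Only the certificates need an argument: the items of full classes
certify those as cheap as the newly paid item, and old certificates serve the dearer ones. -/
theorem KruskalInv.reject [Fintype ι] (h : KruskalInv u v w cost A B lab full x)
    (hw : ∀ a, w a = u a ∨ w a = v a) (hwu : ∀ a, cost (w a) ≤ cost (u a))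
    (hwv : ∀ a, cost (w a) ≤ cost (v a)) {a : α} (ha : a ∉ A ∪ B)
    (hmax : ∀ a' ∉ A ∪ B, cost (w a') ≤ cost (w a))
    (hau : full (lab (u a))) (hav : full (lab (v a))) (hlab : ∀ b, lab' b = lab b)
    (hx : ∀ b, x' b = if b = w a then x b + 1 else x b) :
    KruskalInv u v w cost A (insert a B) lab' full x' := by
  classical
  obtain rfl : lab' = lab := funext hlab
  have haB : a ∉ B := fun haB => ha (Finset.mem_union_right _ haB)
  have hcount : ∀ b, x' b = ((insert a B).filter (w · = b)).card := by
    intro b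
    rw [hx, Finset.filter_insert, h.count b]
    by_cases hb : b = w a
    · rw [if_pos hb, if_pos hb.symm, Finset.card_insert_of_notMem]
      exact fun h' => haB (Finset.mem_filter.1 h').1
    · rw [if_neg hb, if_neg (Ne.symm hb)]
  refine ⟨h.bij, h.same, ?_, ?_, ?_, hcount, ?_, ?_⟩
  · rw [Finset.disjoint_insert_right]
    exact ⟨fun haA => ha (Finset.mem_union_left _ haA), h.disj⟩
  · intro c hc
    rcases Finset.mem_insert.1 hc with rfl | hc
    exacts [hau, h.full_left c hc]
  · intro c hc
    rcases Finset.mem_insert.1 hc with rfl | hc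
    exacts [hav, h.full_right c hc]
  · intro b hb
    have hbB : ∃ c ∈ insert a B, w c = b := by
      rw [hcount b] at hb
      obtain ⟨c, hc⟩ := Finset.card_pos.1 hb
      exact ⟨c, (Finset.mem_filter.1 hc).1, (Finset.mem_filter.1 hc).2⟩
    obtain ⟨c, hc, hcb⟩ := hbB
    have hle : cost (w a) ≤ cost b := by
      rw [← hcb]
      rcases Finset.mem_insert.1 hc with rfl | hc
      · exact le_rfl
      · exact h.order c (Finset.mem_union_right _ hc) a ha
    set W := Finset.univ.filter (fun b => b ∈ endpoints u v ∧ full (lab' b)) with hW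
    have hwW : ∀ c ∈ insert a B, w c ∈ W := by
      intro c hc
      have hf : full (lab' (u c)) ∧ full (lab' (v c)) := by
        rcases Finset.mem_insert.1 hc with rfl | hc
        exacts [⟨hau, hav⟩, ⟨h.full_left c hc, h.full_right c hc⟩]
      simp only [hW, Finset.mem_filter, Finset.mem_univ, true_and]
      rcases hw c with e | e <;> rw [e]
      exacts [⟨⟨c, .inl rfl⟩, hf.1⟩, ⟨⟨c, .inr rfl⟩, hf.2⟩]
    -- In the first case all items of full classes cost at least as much as `b`, since each is an
    -- end of an edge accepted earlier. In the second case the old certificate consists of items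
    -- dearer than `w a`, where `x` is unchanged.
    by_cases heq : cost b ≤ cost (w a)
    · refine ⟨W, hcb ▸ hwW c hc, fun d hd => ?_, fun y hy => ?_⟩
      · have hd' : d ∈ endpoints u v ∧ full (lab' d) := by simpa [hW] using hd
        obtain ⟨Z, hZ⟩ := exists_isTransversal (endpoints u v) lab' full
        obtain ⟨σ, hσ, hσe⟩ := h.bij Z hZ
        obtain ⟨e, he, rfl⟩ := hσ.surjOn ⟨hd'.1, fun hdZ => hZ.free d hdZ hd'.2⟩
        have h1 := h.order e (Finset.mem_union_left _ he) a ha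
        have h2 := hwu e
        have h3 := hwv e
        rcases hσe e with e' | e' <;> rw [e'] <;> linarith
      · have h1 : ∑ d ∈ W, x' d = (insert a B).card := by
          rw [Finset.card_eq_sum_card_fiberwise hwW]
          exact Finset.sum_congr rfl fun d _ => hcount d
        rw [h1]
        exact h.card_le ha hau hav hy
    · have hba : ∀ d, cost b ≤ cost d → x' d = x d := by
        intro d hd
        rw [hx, if_neg]
        rintro rfl; exact heq hd
      obtain ⟨W', h1, h2, h3⟩ := h.cert b (by rwa [← hba b le_rfl])
      refine ⟨W', h1, h2, fun y hy => ?_⟩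
      rw [Finset.sum_congr rfl fun d hd => hba d (h2 d hd)]
      exact h3 y hy
  · intro c hc c' hc'
    rw [Finset.union_insert] at hc hc'
    rcases Finset.mem_insert.1 hc with rfl | hc
    · exact hmax c' fun h => hc' (Finset.mem_insert_of_mem h)
    · exact h.order c hc c' fun h => hc' (Finset.mem_insert_of_mem h)

/-- The accepted edges use at most one copy of each item, and the extra copies are counted so as to
pay for the rejected edges. -/
theorem KruskalInv.feas (h : KruskalInv u v w cost A B lab full x)
    (hw : ∀ a, w a = u a ∨ w a = v a) (hAB : A ∪ B = Finset.univ) : Feas u v x := by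
  obtain ⟨Z, hZ⟩ := exists_isTransversal (endpoints u v) lab full
  obtain ⟨σ, hσ, hσe⟩ := h.bij Z hZ
  refine ⟨fun a => if a ∈ A then σ a else w a, fun a => ?_, fun b => ?_⟩
  · dsimp only
    split_ifs
    exacts [hσe a, hw a]
  · have h1 : Finset.univ.filter (fun a => (if a ∈ A then σ a else w a) = b) ⊆
        B.filter (w · = b) ∪ A.filter (σ · = b) := by
      intro a ha
      have : a ∈ A ∪ B := hAB ▸ Finset.mem_univ a
      grind
    refine (Finset.card_le_card h1).trans ((Finset.card_union_le _ _).trans ?_)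
    rw [h.count b]
    refine Nat.add_le_add_left (Finset.card_le_one.2 fun c hc d hd => ?_) _
    rw [Finset.mem_filter] at hc hd
    exact hσ.injOn hc.1 hd.1 (hc.2.trans hd.2.symm)

end Kruskal

/-! ### Hard persons and popular matchings -/

namespace Instance

variable (I : Instance)

/-- `b` is somebody's first choice. -/
def IsFirst (b : Fin I.m) : Prop := ∃ a, (I.pref a).head? = some b

/-- `a` has two choices, the second of which is nobody's first choice. -/
def Hard (a : Fin I.n) : Prop := ∃ h : (I.pref a).length = 2, ¬ I.IsFirst ((I.pref a)[1])

abbrev HardPerson : Type := {a : Fin I.n // I.Hard a}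

noncomputable instance : Fintype I.HardPerson := Fintype.ofFinite _

def fst (a : I.HardPerson) : Fin I.m := (I.pref a.1)[0]'(by have := a.2.1; omega)

def snd (a : I.HardPerson) : Fin I.m := (I.pref a.1)[1]'(by have := a.2.1; omega)

variable {I}

theorem pref_eq_of_hard (a : I.HardPerson) : I.pref a.1 = [I.fst a, I.snd a] := by
  obtain ⟨u, v, hp⟩ := List.length_eq_two.1 a.2.1
  simp [fst, snd, hp]

theorem not_isFirst_snd (a : I.HardPerson) : ¬ I.IsFirst (I.snd a) := a.2.2

theorem isFirst_fst (a : I.HardPerson) : I.IsFirst (I.fst a) := ⟨a.1, by simp [pref_eq_of_hard]⟩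

theorem fst_ne_snd (a : I.HardPerson) : I.fst a ≠ I.snd a :=
  fun h => not_isFirst_snd a (h ▸ isFirst_fst a)

theorem isFirst_of_mem_of_not_hard (hl : ∀ a, (I.pref a).length ≤ 2) {a : Fin I.n}
    (ha : ¬ I.Hard a) {b : Fin I.m} (hb : b ∈ I.pref a) : I.IsFirst b := by
  by_contra hf
  have h1 : (I.pref a).head? ≠ some b := fun h => hf ⟨a, h⟩
  have h2 := hl a
  unfold Hard at ha
  match hp : I.pref a with
  | [] => simp [hp] at hb
  | [u] => simp [hp] at hb h1; exact h1 hb.symm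
  | [u, v] =>
    simp only [hp, List.mem_cons, List.not_mem_nil, or_false, List.head?_cons, ne_eq,
      Option.some.injEq] at hb h1
    rcases hb with rfl | rfl
    · exact h1 rfl
    · exact ha ⟨by simp [hp], by simpa [hp] using hf⟩
  | _ :: _ :: _ :: _ => simp [hp] at h2

theorem idxOf_eq_zero_iff {l : List (Fin I.m)} {b : Fin I.m} (hb : b ∈ l) :
    l.idxOf b = 0 ↔ l.head? = some b := by
  cases l with
  | nil => simp at hb
  | cons c l => simp [List.idxOf_cons]; grind

theorem feas_of_injective {y : Fin I.m → ℕ} {c : I.HardPerson → I.Copy y}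
    (hc : Function.Injective c) (h : ∀ a, (c a).1 = I.fst a ∨ (c a).1 = I.snd a) :
    Feas I.fst I.snd y := by
  classical
  refine ⟨fun a => (c a).1, h, fun b => ?_⟩
  have h1 : (Finset.univ.image fun i : Fin (y b + 1) => (⟨b, i⟩ : I.Copy y)).card ≤ y b + 1 :=
    Finset.card_image_le.trans (by simp)
  refine le_trans (Finset.card_le_card_of_injOn c (fun a ha => ?_) hc.injOn) h1
  have ha' : (c a).1 = b := by simpa using ha
  subst ha'
  exact Finset.mem_coe.2 (Finset.mem_image.2 ⟨(c a).2, Finset.mem_univ _, rfl⟩)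

theorem exists_injective_of_feas {y : Fin I.m → ℕ} (h : Feas I.fst I.snd y) :
    ∃ c : I.HardPerson → I.Copy y, Function.Injective c ∧
      ∀ a, (c a).1 = I.fst a ∨ (c a).1 = I.snd a := by
  classical
  obtain ⟨g, hg, hc⟩ := h
  have : ∀ b, Nonempty ({a // g a = b} ↪ Fin (y b + 1)) := fun b => by
    refine Function.Embedding.nonempty_of_card_le ?_
    rw [Fintype.card_subtype, Fintype.card_fin]
    exact hc b
  let e : ∀ b, {a // g a = b} ↪ Fin (y b + 1) := fun b => (this b).some
  refine ⟨fun a => ⟨g a, e (g a) ⟨a, rfl⟩⟩, ?_, hg⟩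
  have key : ∀ b b' (a : {a // g a = b}) (a' : {a // g a = b'}),
      (⟨b, e b a⟩ : I.Copy y) = ⟨b', e b' a'⟩ → a.1 = a'.1 := by
    rintro b b' a a' h
    obtain rfl : b = b' := congrArg Sigma.fst h
    rw [(e b).injective (eq_of_heq (Sigma.mk.inj h).2)]
  exact fun a a' h => key _ _ ⟨a, rfl⟩ ⟨a', rfl⟩ h

/-- An unmatched hard person would make the matching lose: she can get her second choice, and its
holder, if there is one, can be promoted. This gains one vote without loss, or two votes against at
most one. -/
theorem IsPopular.feas {y : Fin I.m → ℕ} {M : Fin I.n → Option (I.Copy y)}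
    (hM : I.IsPopular y M) : Feas I.fst I.snd y := by
  classical
  have hmatched : ∀ a : I.HardPerson, M a.1 ≠ none := by
    intro a ha
    apply hM.2
    obtain ⟨⟨hE, hinj⟩, -⟩ := hM
    set p : I.Copy y := ⟨I.snd a, 0⟩ with hp
    have hpa : I.graph y a.1 p := by simp [graph, hp, pref_eq_of_hard]
    by_cases hfree : ∃ a', M a' = some p
    · obtain ⟨a', ha'⟩ := hfree
      have hmem : I.snd a ∈ I.pref a' := hE _ _ ha'
      have hhead : (I.pref a').head? ≠ some (I.snd a) := fun h => not_isFirst_snd a ⟨a', h⟩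
      obtain ⟨u, l, hul⟩ : ∃ u l, I.pref a' = u :: l := by
        cases h : I.pref a' with
        | nil => simp [h] at hmem
        | cons u l => exact ⟨u, l, rfl⟩
      have hne : u ≠ I.snd a := by simpa [hul] using hhead
      -- The holder `a'` of the copy of `snd a` does not rank that item first, so she improves by
      -- moving to a copy `q` of her first choice. Only the previous holder of `q` can lose.
      set q : I.Copy y := ⟨u, 0⟩ with hq
      have hqa : I.graph y a' q := by simp [graph, hq, hul]
      have hpq : p ≠ q := fun h => hne (congrArg Sigma.fst h).symm
      have haa' : a.1 ≠ a' := by rintro h; rw [← h, ha] at ha'; cases ha'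
      let M' : Fin I.n → Option (I.Copy y) := fun c =>
        if c = a.1 then some p else if c = a' then some q else
          if M c = some q then none else M c
      have hM'a : M' a.1 = some p := by simp [M']
      have hM'a' : M' a' = some q := by simp [M', haa'.symm]
      have hrest : ∀ c, c ≠ a.1 → c ≠ a' → M' c = if M c = some q then none else M c :=
        fun c h1 h2 => by simp [M', h1, h2]
      refine ⟨M', ⟨fun c r h => ?_, fun c c' r h h' => ?_⟩, ?_⟩
      · grind
      · grind
      · have h1 : {c | I.Prefers c (M c) (M' c)} ⊆ {c | M c = some q} := by
          intro c hc
          simp only [Set.mem_ofPred_eq] at hc ⊢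
          by_contra hcq
          by_cases h1 : c = a.1
          · rw [h1, ha] at hc; exact hc
          · by_cases h2 : c = a'
            · rw [h2, ha', hM'a'] at hc
              simp [Prefers, hul, hp, hq] at hc
            · rw [hrest c h1 h2, if_neg hcq] at hc
              cases hMc : M c with
              | none => rw [hMc] at hc; exact hc
              | some r => rw [hMc] at hc; exact lt_irrefl _ hc
        have h2 : {a.1, a'} ⊆ {c | I.Prefers c (M' c) (M c)} := by
          rintro c (rfl | rfl)
          · simp [Prefers, hM'a, ha]
          · have : ¬ u = I.snd a := hne
            simp [Prefers, hM'a', ha', hp, hq, hul, this]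
        have h3 : {c | M c = some q}.ncard ≤ 1 :=
          Set.ncard_le_one_iff_subsingleton.2 fun c hc c' hc' => hinj _ _ _ hc hc'
        have h4 := Set.ncard_le_ncard h1 (Set.toFinite _)
        have h5 := Set.ncard_le_ncard h2 (Set.toFinite _)
        rw [Set.ncard_pair haa'] at h5
        unfold votes
        omega
    · push Not at hfree
      have hM' := IsMatching.update ⟨hE, hinj⟩ hpa hfree
      refine ⟨_, hM', ?_⟩
      have h1 : {c | I.Prefers c (M c) (Function.update M a.1 (some p) c)} = ∅ := by
        refine Set.eq_empty_of_forall_notMem fun c hc => ?_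
        simp only [Set.mem_ofPred_eq] at hc
        by_cases hca : c = a.1
        · rw [hca, ha] at hc; exact hc
        · rw [Function.update_of_ne hca] at hc
          cases hMc : M c with
          | none => rw [hMc] at hc; exact hc
          | some r => rw [hMc] at hc; exact lt_irrefl _ hc
      have h2 : a.1 ∈ {c | I.Prefers c (Function.update M a.1 (some p) c) (M c)} := by
        simp [Prefers, ha]
      unfold votes
      rw [h1, Set.ncard_empty]
      exact (Set.ncard_pos (Set.toFinite _)).2 ⟨_, h2⟩
  have h1 : ∀ a : I.HardPerson, ∃ p, M a.1 = some p :=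
    fun a => Option.ne_none_iff_exists'.1 (hmatched a)
  choose c hc using h1
  refine feas_of_injective (c := c) (fun a a' h => ?_) fun a => ?_
  · exact Subtype.ext (hM.1.2 _ _ _ (hc a) (h ▸ hc a'))
  · have := hM.1.1 _ _ (hc a)
    simpa [graph, pref_eq_of_hard] using this

/-! ### Tame vectors: their `f`- and `s`-edges, and popular matchings -/

/-- There are at most as many copies of a first choice `b` as persons whose first choice is `b`. -/
def Tame (x : Fin I.m → ℕ) : Prop :=
  ∀ b, I.IsFirst b → x b + 1 ≤ (Finset.univ.filter fun a => (I.pref a).head? = some b).card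

theorem Tame.zero : I.Tame (fun _ => 0) := by
  rintro b ⟨a, ha⟩
  exact Finset.card_pos.2 ⟨a, by simp [ha]⟩

/-- If some copy of the first choice `b` is free, then so is some person with this first choice. -/
theorem Tame.exists_person {x : Fin I.m → ℕ} (hx : I.Tame x) {b : Fin I.m} (hb : I.IsFirst b)
    {γ : Type} {M : Fin I.n → Option γ} (e : Fin (x b + 1) → γ)
    (hinj : ∀ a a' p, M a = some p → M a' = some p → a = a') {i : Fin (x b + 1)}
    (hfree : ∀ a, M a ≠ some (e i)) :
    ∃ a, (I.pref a).head? = some b ∧ ∀ j, M a ≠ some (e j) := by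
  classical
  by_contra! hcon
  have : ∀ a, ∃ j, (I.pref a).head? = some b → M a = some (e j) := fun a => by
    by_cases h : (I.pref a).head? = some b
    · obtain ⟨j, hj⟩ := hcon a h; exact ⟨j, fun _ => hj⟩
    · exact ⟨i, fun h' => absurd h' h⟩
  choose j hj using this
  have h1 := Finset.card_le_card_of_injOn (s := Finset.univ.filter fun a => (I.pref a).head? = some b)
    (t := Finset.univ.erase i) j (fun a ha => ?_) (fun a ha a' ha' h => ?_)
  · have h2 := hx b hb
    rw [Finset.card_erase_of_mem (Finset.mem_univ _), Finset.card_univ, Fintype.card_fin] at h1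
    omega
  · have ha' : (I.pref a).head? = some b := by simpa using ha
    refine Finset.mem_coe.2 (Finset.mem_erase.2 ⟨fun h => hfree a ?_, Finset.mem_univ _⟩)
    rw [← h]; exact hj a ha'
  · have h2 : (I.pref a).head? = some b := by simpa using ha
    have h3 : (I.pref a').head? = some b := by simpa using ha'
    exact hinj _ _ _ (hj a h2) (h ▸ hj a' h3)

theorem topGraph_inl {x : Fin I.m → ℕ} {a : Fin I.n} {p : I.Copy x} :
    I.topGraph x a (.inl p) ↔ (I.pref a).head? = some p.1 := by
  constructor
  · rintro ⟨h1, h2⟩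
    exact (idxOf_eq_zero_iff h1).1 h2
  · intro h
    have hm : p.1 ∈ I.pref a := List.mem_of_mem_head? h
    exact ⟨hm, (idxOf_eq_zero_iff hm).2 h⟩

theorem topGraph_inr {x : Fin I.m → ℕ} {a a' : Fin I.n} :
    I.topGraph x a (.inr a') ↔ a' = a ∧ I.pref a = [] := by
  simp [topGraph, extGraph, rank]

/-- Posts that are isolated in a graph are even. -/
theorem isEvenIn_of_isolated {α β : Type} [Finite α] {E : α → β → Prop} {p : β}
    (h : ∀ a, ¬ E a p) : IsEvenIn E (.inr p) := by
  obtain ⟨M, hM⟩ := exists_isMaxMatching E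
  refine ⟨M, hM, 0, by simp, .start fun u => ?_⟩
  cases u with
  | inl a => exact fun h' => h a (hM.1.1 _ _ h')
  | inr _ => exact id

/-- The copies of first choices are not even in the graph of the top-ranked edges. -/
theorem Tame.not_isEvenIn {x : Fin I.m → ℕ} (hx : I.Tame x) {p : I.Copy x}
    (hp : I.IsFirst p.1) : ¬ IsEvenIn (I.topGraph x) (.inr (.inl p)) := by
  obtain ⟨b, i₀⟩ := p
  rintro ⟨M, hM, k, hk, hreach⟩
  -- If a copy of `b` were free, some person with first choice `b` would hold no copy of it. She
  -- would be unmatched, as she has no other top-ranked edges, and could be matched to the free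
  -- copy.
  have hall : ∀ i, ∃ a, M a = some (.inl ⟨b, i⟩) := by
    intro i
    by_contra! hfree
    obtain ⟨a, ha, hna⟩ := hx.exists_person hp (fun i => (.inl ⟨b, i⟩ : I.Post x)) hM.1.2 hfree
    have hMa : M a = none := by
      cases hMa : M a with
      | none => rfl
      | some r =>
        exfalso
        have hr := hM.1.1 _ _ hMa
        cases r with
        | inl q =>
          rw [topGraph_inl, ha] at hr
          obtain ⟨c, j⟩ := q
          cases hr
          exact hna j hMa
        | inr a' =>
          rw [topGraph_inr] at hr
          simp [hr.2] at ha
    obtain ⟨c, hc, -⟩ := hM.matched_of_reach (a := a) (p := .inl ⟨b, i⟩) ⟨0, .start hMa⟩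
      (topGraph_inl.2 ha)
    exact hfree c hc
  -- The copies of `b` and the people who rank it first are not joined to the other vertices. No
  -- post among them is unmatched, so alternating walks there start in persons and visit posts only
  -- at odd lengths.
  have key : ∀ (k : ℕ) v, AltReach (I.topGraph x) M k v →
      (Even k → ∀ i, v ≠ .inr (.inl ⟨b, i⟩)) ∧
        (Odd k → ∀ a, v = .inl a → (I.pref a).head? ≠ some b) := by
    intro k v h
    induction h with
    | start h0 =>
      refine ⟨?_, by simp⟩
      rintro - i rfl
      obtain ⟨a, ha⟩ := hall i
      exact h0 (.inl a) ha
    | @outside k u v _ hk hadj _ ih =>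
      refine ⟨fun h => absurd h (Nat.not_even_iff_odd.2 hk.add_one), ?_⟩
      rintro - a rfl ha
      cases u with
      | inl _ => exact hadj
      | inr r =>
        cases r with
        | inl q =>
          have h1 : (I.pref a).head? = some q.1 := topGraph_inl.1 hadj
          obtain ⟨c, j⟩ := q
          rw [ha] at h1
          cases h1
          exact ih.1 hk j rfl
        | inr a' =>
          have h1 := (topGraph_inr.1 hadj).2
          simp [h1] at ha
    | @inside k u v _ hk hm ih =>
      refine ⟨?_, fun h => absurd h (Nat.not_odd_iff_even.2 hk.add_one)⟩
      rintro - i rfl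
      cases u with
      | inl a => exact ih.2 hk a rfl (topGraph_inl.1 (hM.1.1 _ _ hm))
      | inr _ => exact hm
  exact (key k _ hreach).1 hk i₀ rfl

theorem Tame.isEvenIn_iff {x : Fin I.m → ℕ} (hx : I.Tame x) {p : I.Copy x} :
    IsEvenIn (I.topGraph x) (.inr (.inl p)) ↔ ¬ I.IsFirst p.1 :=
  ⟨fun h hp => hx.not_isEvenIn hp h,
    fun h => isEvenIn_of_isolated fun a ha => h ⟨a, topGraph_inl.1 ha⟩⟩

theorem isEvenIn_last {x : Fin I.m → ℕ} {a : Fin I.n} (ha : I.pref a ≠ []) :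
    IsEvenIn (I.topGraph x) (.inr (.inr a)) :=
  isEvenIn_of_isolated fun c hc => by
    obtain ⟨rfl, h⟩ := topGraph_inr.1 hc
    exact ha h

/-- By tameness the copies of her first choice are not even, while those of her second choice are
even and beat her last item; they form her `s`-posts. -/
theorem Tame.fsGraph_of_hard {x : Fin I.m → ℕ} (hx : I.Tame x) (a : I.HardPerson)
    {r : I.Post x} :
    I.fsGraph x a.1 r ↔ ∃ p, r = .inl p ∧ (p.1 = I.fst a ∨ p.1 = I.snd a) := by
  have hp := pref_eq_of_hard a
  have hne := fst_ne_snd a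
  have hgraph : ∀ q : I.Copy x, I.graph x a.1 q ↔ q.1 = I.fst a ∨ q.1 = I.snd a := fun q => by
    simp [graph, hp]
  constructor
  · rintro (h | ⟨h1, h2, h3⟩)
    · cases r with
      | inl p => exact ⟨p, rfl, (hgraph p).1 h.1⟩
      | inr a' => rw [topGraph_inr, hp] at h; simp at h
    · cases r with
      | inl p => exact ⟨p, rfl, (hgraph p).1 h1⟩
      | inr a' =>
        have := h3 (.inl ⟨I.snd a, 0⟩) ((hgraph _).2 (.inr rfl))
          (hx.isEvenIn_iff.2 (not_isFirst_snd a))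
        simp [rank, hp, hne] at this
  · rintro ⟨p, rfl, h | h⟩
    · exact .inl (topGraph_inl.2 (by simp [hp, h]))
    · refine .inr ⟨(hgraph p).2 (.inr h), hx.isEvenIn_iff.2 (h ▸ not_isFirst_snd a), ?_⟩
      rintro (q | a') hq hqe
      · rcases (hgraph q).1 hq with hq | hq
        · exact absurd (isFirst_fst a) (hq ▸ hx.isEvenIn_iff.1 hqe)
        · simp [rank, h, hq]
      · simp [rank, h, hp, hne]

/-- Every item on her list is somebody's first choice and hence not even, so the last item is the
only possible `s`-post. -/
theorem Tame.fsGraph_of_not_hard (hl : ∀ a, (I.pref a).length ≤ 2) {x : Fin I.m → ℕ}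
    (hx : I.Tame x) {a : Fin I.n} (ha : ¬ I.Hard a) {r : I.Post x} :
    I.fsGraph x a r ↔ (∃ p, r = .inl p ∧ (I.pref a).head? = some p.1) ∨ r = .inr a := by
  constructor
  · rintro (h | ⟨h1, h2, h3⟩)
    · cases r with
      | inl p => exact .inl ⟨p, rfl, topGraph_inl.1 h⟩
      | inr a' => exact .inr (congrArg _ (topGraph_inr.1 h).1)
    · cases r with
      | inl p => exact absurd (isFirst_of_mem_of_not_hard hl ha h1) (hx.isEvenIn_iff.1 h2)
      | inr a' => exact .inr (congrArg _ h1)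
  · rintro (⟨p, rfl, h⟩ | rfl)
    · exact .inl (topGraph_inl.2 h)
    · by_cases he : I.pref a = []
      · exact .inl (topGraph_inr.2 ⟨rfl, he⟩)
      · refine .inr ⟨rfl, isEvenIn_last he, ?_⟩
        rintro (q | a') hq hqe
        · exact absurd (isFirst_of_mem_of_not_hard hl ha hq) (hx.isEvenIn_iff.1 hqe)
        · simp [rank]

/-- Persons who are not hard can always be put on their private last items, so a complete matching
only has to serve the hard ones. -/
theorem Tame.feas_iff_done (hl : ∀ a, (I.pref a).length ≤ 2) {x : Fin I.m → ℕ}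
    (hx : I.Tame x) : Feas I.fst I.snd x ↔ I.Done x := by
  classical
  constructor
  · intro h
    obtain ⟨c, hc, hce⟩ := exists_injective_of_feas h
    refine ⟨fun a => if h : I.Hard a then some (.inl (c ⟨a, h⟩)) else some (.inr a),
      ⟨fun a r hr => ?_, fun a a' r hr hr' => ?_⟩, fun a => ?_⟩
    · dsimp only at hr
      split_ifs at hr with ha
      · cases hr
        exact (hx.fsGraph_of_hard ⟨a, ha⟩).2 ⟨_, rfl, hce _⟩
      · cases hr
        exact (hx.fsGraph_of_not_hard hl ha).2 (.inr rfl)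
    · dsimp only at hr hr'
      split_ifs at hr hr' with ha ha'
      · cases hr
        have := hc (Sum.inl_injective (Option.some_injective _ hr'))
        exact (congrArg Subtype.val this).symm
      · cases hr; cases hr'
      · cases hr; cases hr'
      · cases hr; cases hr'; rfl
    · dsimp only
      split_ifs <;> simp
  · rintro ⟨M, hM, hcomp⟩
    have h1 : ∀ a : I.HardPerson, ∃ p, M a.1 = some (.inl p) ∧ (p.1 = I.fst a ∨ p.1 = I.snd a) := by
      intro a
      obtain ⟨r, hr⟩ := Option.ne_none_iff_exists'.1 (hcomp a.1)
      obtain ⟨p, rfl, hp⟩ := (hx.fsGraph_of_hard a).1 (hM.1 _ _ hr)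
      exact ⟨p, hr, hp⟩
    choose c hc hce using h1
    exact feas_of_injective (c := c)
      (fun a a' h => Subtype.ext (hM.2 _ _ _ (hc a) (h ▸ hc a'))) hce

/-- The matchings considered for popularity: every hard person has one of her items, and everybody
else has her first choice or nothing. -/
def Admissible (x : Fin I.m → ℕ) (M : Fin I.n → Option (I.Copy x)) : Prop :=
  IsMatching (I.graph x) M ∧ (∀ a, I.Hard a → M a ≠ none) ∧
    ∀ a p, M a = some p → I.IsFirst p.1 → (I.pref a).head? = some p.1

theorem exists_admissible {x : Fin I.m → ℕ} (h : Feas I.fst I.snd x) :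
    ∃ M, I.Admissible x M := by
  classical
  obtain ⟨c, hc, hce⟩ := exists_injective_of_feas h
  have hM : ∀ a p, (if h : I.Hard a then some (c ⟨a, h⟩) else none) = some p →
      ∃ h : I.Hard a, c ⟨a, h⟩ = p := fun a p hp => by
    split_ifs at hp with ha
    exact ⟨ha, Option.some_injective _ hp⟩
  refine ⟨fun a => if h : I.Hard a then some (c ⟨a, h⟩) else none,
    ⟨fun a p hp => ?_, fun a a' p hp hp' => ?_⟩, fun a ha => by simp [ha], fun a p hp hf => ?_⟩
  · obtain ⟨ha, rfl⟩ := hM a p hp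
    rcases hce ⟨a, ha⟩ with h | h <;>
      simp [graph, h, pref_eq_of_hard ⟨a, ha⟩]
  · obtain ⟨ha, rfl⟩ := hM a p hp
    obtain ⟨ha', h⟩ := hM a' _ hp'
    exact (congrArg Subtype.val (hc h)).symm
  · obtain ⟨ha, rfl⟩ := hM a p hp
    rcases hce ⟨a, ha⟩ with h | h
    · simp [h, show I.pref a = _ from pref_eq_of_hard ⟨a, ha⟩]
    · exact absurd (h ▸ hf) (not_isFirst_snd _)

/-- An admissible matching that covers all copies of all first choices. -/
theorem Tame.exists_covering {x : Fin I.m → ℕ} (hx : I.Tame x) (h : Feas I.fst I.snd x) :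
    ∃ M, I.Admissible x M ∧ ∀ p : I.Copy x, I.IsFirst p.1 → ∃ a, M a = some p := by
  classical
  -- As many people as possible hold their first choice. A free copy of a first choice could go to a
  -- person who ranks it first and does not hold it, which would increase their number.
  obtain ⟨M, hM, hmax⟩ := Set.exists_max_image {M | I.Admissible x M}
    (fun M => {a | ∃ p, M a = some p ∧ (I.pref a).head? = some p.1}.ncard) (Set.toFinite _)
    (exists_admissible h)
  refine ⟨M, hM, ?_⟩
  rintro ⟨b, i⟩ hb
  by_contra! hfree
  obtain ⟨a, ha, hna⟩ := hx.exists_person hb (fun i => (⟨b, i⟩ : I.Copy x)) hM.1.2 hfree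
  have hgr : I.graph x a ⟨b, i⟩ := List.mem_of_mem_head? ha
  have hM' : I.Admissible x (Function.update M a (some ⟨b, i⟩)) := by
    refine ⟨hM.1.update hgr hfree, fun c hc => ?_, fun c p hp hf => ?_⟩
    · by_cases hca : c = a
      · simp [hca]
      · simpa [hca] using hM.2.1 c hc
    · by_cases hca : c = a
      · subst hca
        rw [Function.update_self] at hp
        cases hp
        exact ha
      · rw [Function.update_of_ne hca] at hp
        exact hM.2.2 c p hp hf
  refine absurd (hmax _ hM') (not_le.2 (Set.ncard_lt_ncard ⟨?_, ?_⟩ (Set.toFinite _)))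
  · rintro c ⟨p, hp, hc⟩
    by_cases hca : c = a
    · subst hca
      exact ⟨⟨b, i⟩, by simp, ha⟩
    · exact ⟨p, by rwa [Function.update_of_ne hca], hc⟩
  · intro hs
    obtain ⟨⟨c, j⟩, hp, hc⟩ := hs (a := a) ⟨⟨b, i⟩, by simp, ha⟩
    rw [ha] at hc
    cases hc
    exact hna j hp

/-- Voters for `M'` gain a copy of a first-choice item, and `M` already hands out all such copies,
each to a person who ranks it first. Hence every vote for `M'` is offset by one for `M`. -/
theorem Tame.exists_isPopular (hl : ∀ a, (I.pref a).length ≤ 2) {x : Fin I.m → ℕ}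
    (hx : I.Tame x) (h : Feas I.fst I.snd x) : ∃ M, I.IsPopular x M := by
  classical
  obtain ⟨M, ⟨hM, hhard, hfirst⟩, hcov⟩ := hx.exists_covering h
  refine ⟨M, hM, ?_⟩
  rintro ⟨M', hM', hlt⟩
  refine absurd hlt (not_lt.2 ?_)
  let F : (Fin I.n → Option (I.Copy x)) → Set (Fin I.n) :=
    fun N => {a | ∃ p, N a = some p ∧ I.IsFirst p.1}
  let X : Set (Fin I.n) := {a | ∃ p p', M a = some p ∧ M' a = some p' ∧ p.1 = p'.1 ∧ I.IsFirst p.1}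
  have hXM : X ⊆ F M := fun a ⟨p, p', h1, h2, h3, h4⟩ => ⟨p, h1, h4⟩
  have hXM' : X ⊆ F M' := fun a ⟨p, p', h1, h2, h3, h4⟩ => ⟨p', h2, h3 ▸ h4⟩
  -- Map each person in `F M'` to the holder in `M` of the same copy.
  have hF : (F M').ncard ≤ (F M).ncard := by
    have h1 : ∀ a, ∃ c, a ∈ F M' → ∃ p, M' a = some p ∧ I.IsFirst p.1 ∧ M c = some p := fun a => by
      by_cases ha : a ∈ F M'
      · obtain ⟨p, hp, hf⟩ := ha
        obtain ⟨c, hc⟩ := hcov p hf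
        exact ⟨c, fun _ => ⟨p, hp, hf, hc⟩⟩
      · exact ⟨a, fun h => absurd h ha⟩
    choose φ hφ using h1
    refine Set.ncard_le_ncard_of_injOn φ (fun a ha => ?_) (fun a ha a' ha' he => ?_) (Set.toFinite _)
    · obtain ⟨p, -, hf, hp⟩ := hφ a ha
      exact ⟨p, hp, hf⟩
    · obtain ⟨p, h1, -, h2⟩ := hφ a ha
      obtain ⟨p', h1', -, h2'⟩ := hφ a' ha'
      rw [he, h2'] at h2
      cases h2
      exact hM'.2 _ _ _ h1 h1'
  have hwin : {a | I.Prefers a (M' a) (M a)} ⊆ F M' \ X := by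
    intro a ha
    simp only [Set.mem_ofPred_eq] at ha
    cases hM'a : M' a with
    | none => rw [hM'a] at ha; exact ha.elim
    | some p' =>
      rw [hM'a] at ha
      cases hMa : M a with
      | none =>
        have hnh : ¬ I.Hard a := fun h => hhard a h hMa
        refine ⟨⟨p', hM'a, isFirst_of_mem_of_not_hard hl hnh (hM'.1 _ _ hM'a)⟩, ?_⟩
        rintro ⟨p, _, h1, -⟩
        rw [hMa] at h1
        cases h1
      | some p =>
        rw [hMa] at ha
        have hlt : (I.pref a).idxOf p'.1 < (I.pref a).idxOf p.1 := ha
        have hp : (I.pref a).idxOf p.1 < (I.pref a).length := List.idxOf_lt_length_iff.2 (hM.1 _ _ hMa)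
        -- On a list of length at most two, something strictly better can only be the first choice.
        have h0 : (I.pref a).idxOf p'.1 = 0 := by have := hl a; omega
        refine ⟨⟨p', hM'a, a, (idxOf_eq_zero_iff (hM'.1 _ _ hM'a)).1 h0⟩, ?_⟩
        rintro ⟨q, q', h1, h2, h3, -⟩
        rw [hMa] at h1
        rw [hM'a] at h2
        cases h1; cases h2
        rw [h3] at hlt
        exact lt_irrefl _ hlt
  have hlose : F M \ X ⊆ {a | I.Prefers a (M a) (M' a)} := by
    rintro a ⟨⟨p, hp, hf⟩, hX⟩
    simp only [Set.mem_ofPred_eq]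
    rw [hp]
    cases hM'a : M' a with
    | none => trivial
    | some p' =>
      have h1 := hfirst a p hp hf
      have h0 := (idxOf_eq_zero_iff (hM.1 _ _ hp)).2 h1
      have h0' : (I.pref a).idxOf p'.1 ≠ 0 := fun h => hX ⟨p, p', hp, hM'a, by
        have := (idxOf_eq_zero_iff (hM'.1 _ _ hM'a)).1 h
        rw [h1] at this
        exact Option.some_injective _ this, hf⟩
      show (I.pref a).idxOf p.1 < (I.pref a).idxOf p'.1
      omega
  have h1 := Set.ncard_le_ncard hwin (Set.toFinite _)
  have h2 := Set.ncard_le_ncard hlose (Set.toFinite _)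
  have h3 := Set.ncard_sdiff_add_ncard_of_subset hXM (Set.toFinite _)
  have h4 := Set.ncard_sdiff_add_ncard_of_subset hXM' (Set.toFinite _)
  unfold votes
  omega

end Instance

/-! ### The greedy algorithm -/

namespace Instance

variable {I : Instance}

section Step

variable {x : Fin I.m → ℕ} {M : Fin I.n → Option (I.Post x)}

theorem fsGraph_last {c a : Fin I.n} (h : I.fsGraph x c (.inr a)) : a = c :=
  h.elim (fun h => h.1) fun h => h.1

/-- The last item of a reached person who is not hard would have to be matched, and only she is
adjacent to it. But she is unmatched or was entered through a post adjacent to a hard person, and no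
last item is such a post. -/
theorem Tame.reach_hard (hl : ∀ a, (I.pref a).length ≤ 2) (hx : I.Tame x)
    (hM : IsMaxMatching (I.fsGraph x) M) {a : Fin I.n} (ha : Reach (I.fsGraph x) M a) :
    I.Hard a := by
  obtain ⟨k, hk⟩ := ha
  induction k generalizing a with
  | zero =>
    by_contra hh
    obtain ⟨c, hc, -⟩ := hM.matched_of_reach ⟨0, hk⟩ ((hx.fsGraph_of_not_hard hl hh).2 (.inr rfl))
    obtain rfl := fsGraph_last (hM.1.1 _ _ hc)
    cases hk with
    | start h0 => rw [h0] at hc; cases hc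
  | succ k ih =>
    by_contra hh
    cases hk with
    | @step _ c p _ h he hm =>
      have hch := ih h
      obtain ⟨c', hc', -⟩ := hM.matched_of_reach ⟨k + 1, .step h he hm⟩
        ((hx.fsGraph_of_not_hard hl hh).2 (.inr rfl))
      obtain rfl := fsGraph_last (hM.1.1 _ _ hc')
      rw [hm] at hc'
      cases hc'
      obtain ⟨q, hq, -⟩ := (hx.fsGraph_of_hard ⟨c, hch⟩).1 he
      cases hq

theorem Tame.oddItem_iff (hl : ∀ a, (I.pref a).length ≤ 2) (hx : I.Tame x)
    (hM : IsMaxMatching (I.fsGraph x) M) {b : Fin I.m} :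
    I.OddItem x M b ↔ ∃ a : I.HardPerson, Reach (I.fsGraph x) M a.1 ∧ (b = I.fst a ∨ b = I.snd a) := by
  constructor
  · rintro ⟨i, h⟩
    obtain ⟨a, ha, hE⟩ := oddWrt_post_iff.1 h
    have hh := hx.reach_hard hl hM ha
    obtain ⟨p, hp, hpe⟩ := (hx.fsGraph_of_hard ⟨a, hh⟩).1 hE
    cases hp
    exact ⟨⟨a, hh⟩, ha, hpe⟩
  · rintro ⟨a, ha, hb⟩
    exact ⟨0, oddWrt_post_iff.2 ⟨a.1, ha, (hx.fsGraph_of_hard a).2 ⟨_, rfl, hb⟩⟩⟩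

theorem Tame.exists_oddItem (hl : ∀ a, (I.pref a).length ≤ 2) (hx : I.Tame x)
    (hM : IsMaxMatching (I.fsGraph x) M) (hc : ¬ IsComplete M) : ∃ b, I.OddItem x M b := by
  unfold IsComplete at hc
  push Not at hc
  obtain ⟨a, ha⟩ := hc
  have hr : Reach (I.fsGraph x) M a := ⟨0, .start ha⟩
  exact ⟨_, (hx.oddItem_iff hl hM).2 ⟨⟨a, hx.reach_hard hl hM hr⟩, hr, .inl rfl⟩⟩

/-- All copies of an odd item are matched to reached persons. -/
theorem Tame.matched_of_oddItem (hl : ∀ a, (I.pref a).length ≤ 2) (hx : I.Tame x)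
    (hM : IsMaxMatching (I.fsGraph x) M) {b : Fin I.m} (hb : I.OddItem x M b)
    (i : Fin (x b + 1)) : ∃ a, M a = some (.inl ⟨b, i⟩) ∧ Reach (I.fsGraph x) M a := by
  obtain ⟨a, ha, hab⟩ := (hx.oddItem_iff hl hM).1 hb
  exact hM.matched_of_reach ha ((hx.fsGraph_of_hard a).2 ⟨_, rfl, hab⟩)

/-- If all people who rank the odd item first already hold its copies, a walk can reach them only
from one of themselves. None of them is unmatched, so no walk gets in. -/
theorem Tame.add_oddItem (hl : ∀ a, (I.pref a).length ≤ 2) (hx : I.Tame x)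
    (hM : IsMaxMatching (I.fsGraph x) M) {b : Fin I.m} (hb : I.OddItem x M b) :
    I.Tame (x + Pi.single b 1) := by
  classical
  intro c hc
  by_cases hcb : c = b
  swap
  · simpa [hcb] using hx c hc
  subst hcb
  rw [Pi.add_apply, Pi.single_eq_same]
  by_contra hlt
  have hcard : (Finset.univ.filter fun a => (I.pref a).head? = some c).card = x c + 1 := by
    have := hx c hc; omega
  choose φ hφ hφr using hx.matched_of_oddItem hl hM hb
  have hhead : ∀ a : Fin I.n, Reach (I.fsGraph x) M a → ∀ i, I.fsGraph x a (.inl ⟨c, i⟩) →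
      (I.pref a).head? = some c := by
    intro a ha i hE
    have hh := hx.reach_hard hl hM ha
    obtain ⟨p, hp, hpe⟩ := (hx.fsGraph_of_hard ⟨a, hh⟩).1 hE
    cases hp
    rcases hpe with h | h
    · rw [show I.pref a = _ from pref_eq_of_hard ⟨a, hh⟩, List.head?_cons]
      exact congrArg _ h.symm
    · exact absurd (h ▸ hc) (not_isFirst_snd ⟨a, hh⟩)
  have hinj : Function.Injective φ := fun i j hij => by
    have h1 := hφ i
    rw [hij, hφ j] at h1
    simpa using h1.symm
  -- The holders of the copies rank `c` first, being reached and hence hard; by counting, they are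
  -- all the people who rank it first.
  have himg : Finset.univ.image φ = Finset.univ.filter fun a => (I.pref a).head? = some c := by
    refine Finset.eq_of_subset_of_card_le (fun a ha => ?_) ?_
    · obtain ⟨i, -, rfl⟩ := Finset.mem_image.1 ha
      simpa using hhead _ (hφr i) i (hM.1.1 _ _ (hφ i))
    · rw [hcard, Finset.card_image_of_injective _ hinj]; simp
  have hno : ∀ k a, PReach (I.fsGraph x) M k a → (I.pref a).head? ≠ some c := by
    intro k
    induction k with
    | zero =>
      intro a h ha
      have : a ∈ Finset.univ.image φ := by rw [himg]; simpa using ha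
      obtain ⟨i, -, rfl⟩ := Finset.mem_image.1 this
      cases h with
      | start h0 => rw [hφ i] at h0; cases h0
    | succ k ih =>
      intro a h ha
      have : a ∈ Finset.univ.image φ := by rw [himg]; simpa using ha
      obtain ⟨i, -, rfl⟩ := Finset.mem_image.1 this
      cases h with
      | @step _ d p _ h he hm =>
        rw [hφ i] at hm
        cases hm
        exact ih d h (hhead d ⟨k, h⟩ i he)
  obtain ⟨k, hk⟩ := hφr 0
  exact hno k _ hk (hhead _ ⟨k, hk⟩ 0 (hM.1.1 _ _ (hφ 0)))

/-- The exchange step of the greedy algorithm. -/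
theorem Tame.exchange (hl : ∀ a, (I.pref a).length ≤ 2) (hx : I.Tame x)
    (hM : IsMaxMatching (I.fsGraph x) M) {b : Fin I.m} (hb : I.OddItem x M b)
    {y : Fin I.m → ℕ} (hy : Feas I.fst I.snd y) (hxy : x ≤ y) :
    ∃ y' c, I.OddItem x M c ∧ x c < y c ∧ Feas I.fst I.snd y' ∧
      y' + Pi.single c 1 = y + Pi.single b 1 := by
  classical
  obtain ⟨a₀, ⟨k, hk⟩, hab⟩ := (hx.oddItem_iff hl hM).1 hb
  -- The post `none` plays the new copy of `b`. Augmenting towards it makes the reached persons hold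
  -- all copies of odd items and this one as well.
  let E : Fin I.n → Option (I.Post x) → Prop := fun a r =>
    match r with
    | none => ∃ h : I.Hard a, b = I.fst ⟨a, h⟩ ∨ b = I.snd ⟨a, h⟩
    | some r => I.fsGraph x a r
  let M₀ : Fin I.n → Option (Option (I.Post x)) := fun a => (M a).map some
  have hM₀ : ∀ a r, M₀ a = some (some r) ↔ M a = some r := fun a r => by
    cases h : M a <;> simp [M₀, h]
  have hM₀n : ∀ a, M₀ a ≠ some none := fun a => by
    cases h : M a <;> simp [M₀, h]
  have hmatch : IsMatching E M₀ := by
    refine ⟨fun a r hr => ?_, fun a a' r hr hr' => ?_⟩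
    · cases r with
      | none => exact absurd hr (hM₀n a)
      | some r => exact hM.1.1 _ _ ((hM₀ a r).1 hr)
    · cases r with
      | none => exact absurd hr (hM₀n a)
      | some r => exact hM.1.2 _ _ _ ((hM₀ a r).1 hr) ((hM₀ a' r).1 hr')
  have hto : ∀ {j a}, PReach (I.fsGraph x) M j a → PReach E M₀ j a := by
    intro j a h
    induction h with
    | start h0 => exact .start (by simp [M₀, h0])
    | step _ he hm ih => exact .step ih (p := some _) he ((hM₀ _ _).2 hm)
  have hof : ∀ {j a}, PReach E M₀ j a → PReach (I.fsGraph x) M j a := by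
    intro j a h
    induction h with
    | start h0 => exact .start (by simpa [M₀] using h0)
    | @step _ _ r _ _ he hm ih =>
      cases r with
      | none => exact absurd hm (hM₀n _)
      | some r => exact .step ih he ((hM₀ _ _).1 hm)
  obtain ⟨M₁, h1, h2, h3, -, -⟩ := hmatch.augment (p := none) (hto hk) ⟨a₀.2, hab⟩ hM₀n
  -- Hard persons without an item in `M₁` get their first choice by default; this is harmless, since
  -- `Feas.exchange` needs only lower bounds on the counts.
  let h : I.HardPerson → Fin I.m := fun a =>
    match M₁ a.1 with
    | some (some (.inl p)) => p.1
    | some none => b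
    | _ => I.fst a
  refine hy.exchange hxy (R := {a | Reach (I.fsGraph x) M a.1}) (RI := {c | I.OddItem x M c})
    (h := h) (fun a ha => ⟨(hx.oddItem_iff hl hM).2 ⟨a, ha, .inl rfl⟩,
      (hx.oddItem_iff hl hM).2 ⟨a, ha, .inr rfl⟩⟩) (fun a => ?_) hb (fun c hc => ?_)
  · have he := h1.1 a.1
    match hM₁ : M₁ a.1 with
    | none => simp [h, hM₁]
    | some none =>
      obtain ⟨_, h'⟩ := he _ hM₁
      simpa [h, hM₁] using h'
    | some (some (.inl p)) =>
      obtain ⟨q, hq, hqe⟩ := (hx.fsGraph_of_hard a).1 (he _ hM₁)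
      cases hq
      simpa [h, hM₁] using hqe
    | some (some (.inr a')) => simp [h, hM₁]
  · let S : Finset (Option (I.Post x)) :=
      (Finset.univ.image fun i : Fin (x c + 1) => some (.inl ⟨c, i⟩)) ∪ if c = b then {none} else ∅
    have hS : x c + 1 + (Pi.single b 1 : Fin I.m → ℕ) c ≤ S.card := by
      rw [Finset.card_union_of_disjoint, Finset.card_image_of_injective]
      · by_cases hcb : c = b
        · subst hcb; simp
        · simp [hcb]
      · intro i j hij
        simpa using hij
      · rw [Finset.disjoint_left]
        intro r hr
        obtain ⟨i, -, rfl⟩ := Finset.mem_image.1 hr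
        split_ifs <;> simp
    refine hS.trans (Finset.card_le_card_of_surjOn (fun a : I.HardPerson => (M₁ a.1).getD none) ?_)
    intro r hr
    have hr' : (∃ i, r = some (.inl ⟨c, i⟩)) ∨ (r = none ∧ c = b) := by
      rcases Finset.mem_union.1 hr with hr | hr
      · obtain ⟨i, -, rfl⟩ := Finset.mem_image.1 hr; exact .inl ⟨i, rfl⟩
      · split_ifs at hr with hcb
        · exact .inr ⟨by simpa using hr, hcb⟩
        · simp at hr
    have : ∃ a, M₁ a = some r ∧ Reach (I.fsGraph x) M a := by
      have hcov : ∃ a, M₁ a = some r := by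
        refine h2 r ?_
        rcases hr' with ⟨i, rfl⟩ | ⟨rfl, -⟩
        · obtain ⟨a, ha, -⟩ := hx.matched_of_oddItem hl hM hc i
          exact .inr ⟨a, (hM₀ _ _).2 ha⟩
        · exact .inl rfl
      obtain ⟨a, ha⟩ := hcov
      refine ⟨a, ha, ?_⟩
      -- A holder whose post did not change was already the holder of a copy of an odd item, and
      -- those are reached.
      rcases h3 a with h3 | ⟨j, hj⟩
      · rw [ha] at h3
        rcases hr' with ⟨i, rfl⟩ | ⟨rfl, -⟩
        · obtain ⟨a', ha', hra⟩ := hx.matched_of_oddItem hl hM hc i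
          rwa [hM.1.2 _ _ _ ((hM₀ _ _).1 h3.symm) ha']
        · exact absurd h3.symm (hM₀n a)
      · exact ⟨j, hof hj⟩
    obtain ⟨a, ha, hra⟩ := this
    refine ⟨⟨a, hx.reach_hard hl hM hra⟩, ?_, by simp [ha]⟩
    simp only [Finset.coe_filter, Finset.mem_univ, true_and, Set.mem_ofPred_eq]
    refine ⟨hra, ?_⟩
    rcases hr' with ⟨i, rfl⟩ | ⟨rfl, rfl⟩ <;> simp [h, ha]

end Step

theorem totalCost_add_single (x : Fin I.m → ℕ) (b : Fin I.m) :
    I.totalCost (x + Pi.single b 1) = I.totalCost x + I.cost b := by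
  simp [totalCost, add_mul, Finset.sum_add_distrib, Pi.single_apply]

theorem totalCost_mono {x y : Fin I.m → ℕ} (h : x ≤ y) : I.totalCost x ≤ I.totalCost y :=
  Finset.sum_le_sum fun b _ =>
    mul_le_mul_of_nonneg_right (Nat.cast_le.2 (h b)) (I.cost_nonneg b)

theorem update_eq_add_single (x : Fin I.m → ℕ) (b : Fin I.m) :
    Function.update x b (x b + 1) = x + Pi.single b 1 := by
  funext c
  by_cases hc : c = b
  · subst hc; simp
  · simp [hc]

theorem exists_feas_sum_le : ∃ y, Feas I.fst I.snd y ∧ ∑ b, y b ≤ I.n := by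
  classical
  -- All hard persons take their first choice; one copy of every item is even to spare.
  refine ⟨fun b => (Finset.univ.filter (I.fst · = b)).card,
    ⟨I.fst, fun _ => .inl rfl, fun b => Nat.le_succ _⟩, ?_⟩
  rw [← Finset.card_eq_sum_card_fiberwise fun _ _ => Finset.mem_univ _, Finset.card_univ]
  simpa using Fintype.card_le_of_injective (Subtype.val : I.HardPerson → Fin I.n)
    Subtype.val_injective

/-- The comparison vector is changed by one exchange per iteration. Keeping its sum equal to that of
`y₀` bounds the number of iterations, and keeping its cost down gives optimality. -/
theorem GreedyReach.inv (hl : ∀ a, (I.pref a).length ≤ 2) {k : ℕ} {x : Fin I.m → ℕ}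
    (h : I.GreedyReach k x) :
    I.Tame x ∧ ∑ b, x b = k ∧ ∀ y₀, Feas I.fst I.snd y₀ →
      ∃ y, Feas I.fst I.snd y ∧ x ≤ y ∧ ∑ b, y b = ∑ b, y₀ b ∧ I.totalCost y ≤ I.totalCost y₀ := by
  induction h with
  | start => exact ⟨Tame.zero, by simp, fun y₀ h => ⟨y₀, h, fun _ => Nat.zero_le _, rfl, le_rfl⟩⟩
  | @step k x z _ hstep ih =>
    obtain ⟨hx, hk, hy⟩ := ih
    obtain ⟨M, b, hM, -, hb, hmin, rfl⟩ := hstep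
    rw [update_eq_add_single]
    refine ⟨hx.add_oddItem hl hM hb, ?_, fun y₀ hy₀ => ?_⟩
    · simp [Finset.sum_add_distrib, hk]
    · obtain ⟨y, hyf, hxy, hys, hyc⟩ := hy y₀ hy₀
      obtain ⟨y', c, hc, hlt, hy'f, hy'⟩ := hx.exchange hl hM hb hyf hxy
      refine ⟨y', hy'f, fun d => ?_, ?_, ?_⟩
      · have h1 := congrFun hy' d
        have h2 := hxy d
        simp only [Pi.add_apply, Pi.single_apply] at h1 ⊢
        grind
      · have h1 := congrArg (fun z => ∑ d, z d) hy'
        simp [Finset.sum_add_distrib] at h1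
        rw [h1, hys]
      · have h1 := congrArg I.totalCost hy'
        rw [totalCost_add_single, totalCost_add_single] at h1
        have := hmin c hc
        linarith

theorem GreedyReach.isMinCostAugmentation (hl : ∀ a, (I.pref a).length ≤ 2) {k : ℕ}
    {x : Fin I.m → ℕ} (h : I.GreedyReach k x) (hd : I.Done x) : I.IsMinCostAugmentation x := by
  obtain ⟨hx, -, hy⟩ := h.inv hl
  refine ⟨hx.exists_isPopular hl ((hx.feas_iff_done hl).2 hd), ?_⟩
  rintro y₀ ⟨M, hM⟩
  obtain ⟨y, -, hxy, -, hc⟩ := hy y₀ hM.feas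
  exact (totalCost_mono hxy).trans hc

theorem GreedyReach.le (hl : ∀ a, (I.pref a).length ≤ 2) {k : ℕ}
    {x : Fin I.m → ℕ} (h : I.GreedyReach k x) : k ≤ I.n := by
  obtain ⟨-, hk, hy⟩ := h.inv hl
  obtain ⟨y₀, hy₀, hs⟩ := I.exists_feas_sum_le
  obtain ⟨y, -, hxy, hys, -⟩ := hy y₀ hy₀
  rw [← hk]
  exact (Finset.sum_le_sum fun b _ => hxy b).trans (hys.trans_le hs)

theorem exists_isMaxMatching_not_isComplete {x : Fin I.m → ℕ} (hd : ¬ I.Done x) :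
    ∃ M, IsMaxMatching (I.fsGraph x) M ∧ ¬ IsComplete M := by
  obtain ⟨M, hM⟩ := exists_isMaxMatching (I.fsGraph x)
  exact ⟨M, hM, fun h => hd ⟨M, hM.1, h⟩⟩

theorem exists_cheapest_oddItem {x : Fin I.m → ℕ} {M : Fin I.n → Option (I.Post x)}
    (h : ∃ b, I.OddItem x M b) :
    ∃ b, I.OddItem x M b ∧ ∀ b', I.OddItem x M b' → I.cost b ≤ I.cost b' := by
  obtain ⟨b, hb, hmin⟩ := Set.exists_min_image {b | I.OddItem x M b} I.cost (Set.toFinite _) h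
  exact ⟨b, hb, hmin⟩

theorem GreedyReach.exists_step (hl : ∀ a, (I.pref a).length ≤ 2) {k : ℕ}
    {x : Fin I.m → ℕ} (h : I.GreedyReach k x) (hd : ¬ I.Done x) : ∃ y, I.GreedyStep x y := by
  obtain ⟨hx, -, -⟩ := h.inv hl
  obtain ⟨M, hM, hc⟩ := exists_isMaxMatching_not_isComplete hd
  obtain ⟨b, hb, hmin⟩ := exists_cheapest_oddItem (hx.exists_oddItem hl hM hc)
  exact ⟨_, M, b, hM, hc, hb, hmin, rfl⟩

/-- Certified feasible vectors are outputs of the greedy algorithm. -/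
theorem GreedyReach.of_certified (hl : ∀ a, (I.pref a).length ≤ 2) {y : Fin I.m → ℕ}
    (hy : Feas I.fst I.snd y) (hcert : Certified I.fst I.snd I.cost y) {k : ℕ}
    {x : Fin I.m → ℕ} (h : I.GreedyReach k x) (hxy : x ≤ y) :
    ∃ k, I.GreedyReach k y ∧ I.Done y := by
  generalize hd : ∑ b, y b - ∑ b, x b = d
  induction d using Nat.strong_induction_on generalizing k x with
  | _ d ih =>
    obtain ⟨hx, -, -⟩ := h.inv hl
    by_cases hdone : I.Done x
    · have hxf := (hx.feas_iff_done hl).2 hdone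
      -- A certificate for an item with `x b < y b` would bound the copies of `y` on `W` by those of
      -- the feasible `x`, which are strictly fewer.
      have : x = y := by
        by_contra hne
        obtain ⟨b, hb⟩ : ∃ b, x b ≠ y b := by
          by_contra! hall; exact hne (funext hall)
        have hlt : x b < y b := lt_of_le_of_ne (hxy b) hb
        obtain ⟨W, hbW, -, hW⟩ := hcert b (by omega)
        exact absurd (hW x hxf) (not_le.2 (Finset.sum_lt_sum (fun c _ => hxy c) ⟨b, hbW, hlt⟩))
      subst this
      exact ⟨k, h, hdone⟩
    · obtain ⟨M, hM, hc⟩ := exists_isMaxMatching_not_isComplete hdone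
      obtain ⟨b, hb, hmin⟩ := exists_cheapest_oddItem (hx.exists_oddItem hl hM hc)
      obtain ⟨y', c, hco, hlt, hy'f, hy'⟩ := hx.exchange hl hM hb hy hxy
      -- Were `b` cheaper than `c`, it would lie outside the certificate of `c`, and the trade would
      -- leave too few copies inside it. So `c` is a cheapest odd item too, and adding it keeps the
      -- vector below `y`.
      have hcb : I.cost c ≤ I.cost b := by
        obtain ⟨W, hcW, hWc, hW⟩ := hcert c (by omega)
        by_contra hcon
        have hbW : b ∉ W := fun h => hcon (hWc b h)
        have h1 : ∑ d ∈ W, y' d + 1 = ∑ d ∈ W, y d := by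
          have h2 : ∑ d ∈ W, (y' + Pi.single c 1 : Fin I.m → ℕ) d =
              ∑ d ∈ W, (y + Pi.single b 1 : Fin I.m → ℕ) d := by rw [hy']
          simpa [Finset.sum_add_distrib, Pi.single_apply, hcW, hbW] using h2
        have := hW y' hy'f
        omega
      have hstep : I.GreedyStep x (x + Pi.single c 1) :=
        ⟨M, c, hM, hc, hco, fun b' hb' => hcb.trans (hmin b' hb'), (update_eq_add_single _ _).symm⟩
      have hle : x + Pi.single c 1 ≤ y := fun e => by
        have := hxy e
        simp only [Pi.add_apply, Pi.single_apply]
        grind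
      have hsum : ∑ e, (x + Pi.single c 1 : Fin I.m → ℕ) e = ∑ e, x e + 1 := by
        simp [Finset.sum_add_distrib]
      have hle' : ∑ e, (x + Pi.single c 1 : Fin I.m → ℕ) e ≤ ∑ e, y e := Finset.sum_le_sum fun e _ => hle e
      exact ih _ (by omega) (h.step hstep) hle rfl

end Instance

/-! ### Total correctness with time bounds -/

section Machine

@[simp] theorem Mem.setReg_reg (s : Mem) (i v j : ℕ) :
    (s.setReg i v).reg j = if j = i then v else s.reg j := by
  simp [Mem.setReg, Function.update_apply]

@[simp] theorem Mem.setReg_arr (s : Mem) (i v : ℕ) : (s.setReg i v).arr = s.arr := rfl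

@[simp] theorem Mem.setArr_reg (s : Mem) (t i v : ℕ) : (s.setArr t i v).reg = s.reg := rfl

@[simp] theorem Mem.setArr_arr (s : Mem) (t i v t' j : ℕ) :
    (s.setArr t i v).arr t' j = if t' = t then if j = i then v else s.arr t j else s.arr t' j := by
  by_cases h : t' = t
  · subst h; simp [Mem.setArr, Function.update_apply]
  · simp [Mem.setArr, h]

variable {cost : ℕ → ℝ}

/-- Started in `s`, the program `p` halts after at most `T` steps in a state with `Q`. -/
def Ends (cost : ℕ → ℝ) (p : Prog) (s : Mem) (T : ℕ) (Q : Mem → Prop) : Prop :=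
  ∃ t s', Run cost p s t s' ∧ t ≤ T ∧ Q s'

/-- A bound for the running time of a loop-free program. -/
def Prog.time : Prog → ℕ
  | .seq p q => p.time + q.time
  | .ite _ p q => max p.time q.time + 1
  | _ => 1

/-- The weakest precondition of a loop-free program. -/
def Prog.wp (cost : ℕ → ℝ) : Prog → (Mem → Prop) → Mem → Prop
  | .const i k, Q, s => Q (s.setReg i k)
  | .copy i j, Q, s => Q (s.setReg i (s.reg j))
  | .inc i, Q, s => Q (s.setReg i (s.reg i + 1))
  | .dec i, Q, s => Q (s.setReg i (s.reg i - 1))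
  | .load i t j, Q, s => Q (s.setReg i (s.arr t (s.reg j)))
  | .store t i j, Q, s => Q (s.setArr t (s.reg i) (s.reg j))
  | .seq p q, Q, s => p.wp cost (q.wp cost Q) s
  | .ite c p q, Q, s => (c.Holds cost s → p.wp cost Q s) ∧ (¬ c.Holds cost s → q.wp cost Q s)
  | .while _ _, _, _ => False

theorem Ends.mono {p : Prog} {s : Mem} {T T' : ℕ} {Q Q' : Mem → Prop} (h : Ends cost p s T Q)
    (hT : T ≤ T') (hQ : ∀ s, Q s → Q' s) : Ends cost p s T' Q' := by
  obtain ⟨t, s', h1, h2, h3⟩ := h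
  exact ⟨t, s', h1, h2.trans hT, hQ _ h3⟩

theorem Ends.seq {p q : Prog} {s : Mem} {T T' : ℕ} {Q R : Mem → Prop} (h : Ends cost p s T Q)
    (h' : ∀ s, Q s → Ends cost q s T' R) : Ends cost (.seq p q) s (T + T') R := by
  obtain ⟨t, s', h1, h2, h3⟩ := h
  obtain ⟨t', s'', h1', h2', h3'⟩ := h' s' h3
  exact ⟨t + t', s'', .seq h1 h1', by omega, h3'⟩

theorem Ends.ite {c : Test} {p q : Prog} {s : Mem} {T : ℕ} {Q : Mem → Prop}
    (h : c.Holds cost s → Ends cost p s T Q) (h' : ¬ c.Holds cost s → Ends cost q s T Q) :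
    Ends cost (.ite c p q) s (T + 1) Q := by
  by_cases hc : c.Holds cost s
  · obtain ⟨t, s', h1, h2, h3⟩ := h hc
    exact ⟨t + 1, s', .iteTrue hc h1, by omega, h3⟩
  · obtain ⟨t, s', h1, h2, h3⟩ := h' hc
    exact ⟨t + 1, s', .iteFalse hc h1, by omega, h3⟩

theorem Ends.of_wp {p : Prog} {s : Mem} {Q : Mem → Prop} (h : p.wp cost Q s) :
    Ends cost p s p.time Q := by
  induction p generalizing s Q with
  | const i k => exact ⟨_, _, .const, le_rfl, h⟩
  | copy i j => exact ⟨_, _, .copy, le_rfl, h⟩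
  | inc i => exact ⟨_, _, .inc, le_rfl, h⟩
  | dec i => exact ⟨_, _, .dec, le_rfl, h⟩
  | load i t j => exact ⟨_, _, .load, le_rfl, h⟩
  | store t i j => exact ⟨_, _, .store, le_rfl, h⟩
  | seq p q ihp ihq => exact (ihp h).seq fun _ => ihq
  | ite c p q ihp ihq =>
    exact .ite (fun hc => (ihp (h.1 hc)).mono (le_max_left _ _) fun _ => id)
      fun hc => (ihq (h.2 hc)).mono (le_max_right _ _) fun _ => id
  | _ => exact h.elim

/-- `for i in [0, N)`, where the bound is in register `N`. -/
def Prog.loop (i N : ℕ) (p : Prog) : Prog :=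
  .seq (.const i 0) (.while (.lt i N) (.seq p (.inc i)))

/-- Each pass costs two extra steps, for the test and the increment; the final `2` pays for setting
the counter and for the failing test. The invariant refers to the state after the increment, hence
the `setReg` in `hstep`. -/
theorem Ends.loop {i N n T : ℕ} {p : Prog} {Inv : ℕ → Mem → Prop} (hiN : N ≠ i) {s : Mem}
    (hN : s.reg N = n) (h0 : Inv 0 (s.setReg i 0))
    (hstep : ∀ k < n, ∀ s, s.reg i = k → s.reg N = n → Inv k s → Ends cost p s T fun s' =>
      s'.reg i = k ∧ s'.reg N = n ∧ Inv (k + 1) (s'.setReg i (k + 1))) :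
    Ends cost (.loop i N p) s (n * (T + 2) + 2) fun s' => s'.reg N = n ∧ Inv n s' := by
  have key : ∀ d k s, k + d = n → s.reg i = k → s.reg N = n → Inv k s →
      Ends cost (.while (.lt i N) (.seq p (.inc i))) s (d * (T + 2) + 1)
        fun s' => s'.reg N = n ∧ Inv n s' := by
    intro d
    induction d with
    | zero =>
      intro k s hk hi hN hI
      obtain rfl : k = n := by omega
      exact ⟨1, s, .whileFalse (by simp [Test.Holds, hi, hN]), by omega, hN, hI⟩
    | succ d ih =>
      intro k s hk hi hN hI
      obtain ⟨t, s', h1, h2, h3, h4, h5⟩ := hstep k (by omega) s hi hN hI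
      obtain ⟨t', s'', h1', h2', h3'⟩ := ih (k + 1) (s'.setReg i (k + 1)) (by omega) (by simp)
        (by simp [hiN, h4]) h5
      refine ⟨(t + 1) + t' + 1, s'', .whileTrue (by simp [Test.Holds, hi, hN]; omega)
        (.seq h1 .inc) (by rwa [h3]), ?_, h3'⟩
      rw [add_mul]
      omega
  obtain ⟨t, s', h1, h2, h3⟩ := key n 0 (s.setReg i 0) (by omega) (by simp)
    (by simp [hiN, hN]) h0
  exact ⟨1 + t, s', .seq .const h1, by omega, h3⟩

end Machine

/-! ### The program -/

/-! Register 0 holds the number of people, registers 2, 3, 4 hold the constants 1, 0, 2, and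
register 5 is the loop variable that runs through the people. Array 4 marks the first choices,
array 5 holds the cheaper items of the hard persons, array 6 marks the hard persons that are not
yet processed, array 7 holds the labels of the items, and array 8 marks the full labels. -/

/-- Here and below, `.const 7 0` is an idle branch: register 7 is scratch. -/
def markFirst : Prog :=
  .seq (.load 7 0 5) (.ite (.eq 7 3) (.const 7 0) (.seq (.load 8 1 5) (.store 4 8 2)))

def initPerson : Prog :=
  .seq (.load 7 0 5) (.ite (.eq 7 4)
    (.seq (.load 15 1 5) (.seq (.load 16 2 5) (.seq (.load 8 4 16) (.ite (.eq 8 3)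
      (.seq (.store 6 5 2) (.seq (.store 7 15 15) (.seq (.store 7 16 16)
        (.ite (.costLt 16 15) (.store 5 5 16) (.store 5 5 15)))))
      (.const 7 0)))))
    (.const 7 0))

/-- Compares a person with the best unprocessed hard person found so far, which is in register 10
if register 9 holds 1. -/
def scanPerson : Prog :=
  .seq (.load 7 6 5) (.ite (.eq 7 2)
    (.ite (.eq 9 3) (.seq (.const 9 1) (.copy 10 5))
      (.seq (.load 7 5 5) (.seq (.load 8 5 10) (.ite (.costLt 8 7) (.copy 10 5) (.const 7 0)))))
    (.const 7 0))

def relabelPerson : Prog :=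
  .seq (.load 15 1 5) (.seq (.load 7 7 15) (.seq (.ite (.eq 7 11) (.store 7 15 12) (.const 7 0))
    (.seq (.load 15 2 5) (.seq (.load 7 7 15) (.ite (.eq 7 11) (.store 7 15 12) (.const 7 0))))))

def fetchLabels : Prog :=
  .seq (.store 6 10 3) (.seq (.load 15 1 10) (.seq (.load 16 2 10) (.seq (.load 11 7 15)
    (.seq (.load 12 7 16) (.seq (.load 13 8 11) (.load 14 8 12))))))

def reject : Prog := .seq (.load 7 5 10) (.seq (.load 8 3 7) (.seq (.inc 8) (.store 3 7 8)))

/-- The merged class will carry the label in register 12. It becomes full if the class of the first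
item was full or if the edge closes a cycle; a mark already present at that label stays. -/
def setFull : Prog :=
  .ite (.eq 13 2) (.store 8 12 2) (.ite (.eq 11 12) (.store 8 12 2) (.const 7 0))

def accept : Prog := .seq setFull (.loop 5 0 relabelPerson)

def process : Prog :=
  .seq fetchLabels (.ite (.eq 13 2) (.ite (.eq 14 2) reject accept) accept)

def round : Prog :=
  .seq (.const 9 0) (.seq (.loop 5 0 scanPerson) (.ite (.eq 9 2) process (.const 7 0)))

/-- The program. -/
def program : Prog :=
  .seq (.seq (.const 2 1) (.const 4 2)) (.seq (.loop 5 0 markFirst) (.seq (.loop 5 0 initPerson)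
    (.loop 6 0 round)))

/-! ### Correctness of the program -/

namespace Instance

variable (I : Instance)

/-- The registers that do not change. -/
structure Regs (s : Mem) : Prop where
  r0 : s.reg 0 = I.n
  r2 : s.reg 2 = 1
  r3 : s.reg 3 = 0
  r4 : s.reg 4 = 2

/-- The arrays that do not change. -/
structure Input (arr : ℕ → ℕ → ℕ) : Prop where
  a0 : ∀ a, arr 0 a = I.listLength a
  a1 : ∀ a, arr 1 a = I.choice 0 a
  a2 : ∀ a, arr 2 a = I.choice 1 a

/-- Hardness as read off the input arrays. Item `0` is also the default for a missing choice, so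
empty lists have to be excluded. -/
def HardNat (a : ℕ) : Prop :=
  a < I.n ∧ I.listLength a = 2 ∧ ∀ c < I.n, I.listLength c ≠ 0 → I.choice 0 c ≠ I.choice 1 a

/-- The cheaper item of a person, as the program computes it. -/
noncomputable def cheaperNat (a : ℕ) : ℕ :=
  if I.costArray (I.choice 1 a) < I.costArray (I.choice 0 a) then I.choice 1 a else I.choice 0 a

/-- The cheaper item of a hard person. -/
noncomputable def cheaper (a : I.HardPerson) : Fin I.m :=
  if I.cost (I.snd a) < I.cost (I.fst a) then I.snd a else I.fst a

variable {I}

theorem ends_markFirst {s : Mem} (hr : I.Regs s) (hi : I.Input s.arr)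
    (h0 : ∀ t ≥ 3, ∀ i, s.arr t i = 0) :
    Ends I.costArray (.loop 5 0 markFirst) s (I.n * (markFirst.time + 2) + 2) fun s =>
      I.Regs s ∧ I.Input s.arr ∧
      (∀ b, s.arr 4 b = 0 ↔ ∀ a < I.n, I.listLength a ≠ 0 → I.choice 0 a ≠ b) ∧
      ∀ t ≥ 5, ∀ i, s.arr t i = 0 ∧ s.arr 3 i = 0 := by
  refine (Ends.loop (n := I.n) (Inv := fun k s => I.Regs s ∧ I.Input s.arr ∧
      (∀ b, s.arr 4 b = 0 ↔ ∀ a < k, I.listLength a ≠ 0 → I.choice 0 a ≠ b) ∧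
      ∀ t ≥ 5, ∀ i, s.arr t i = 0 ∧ s.arr 3 i = 0) (by decide) hr.r0 ?_ ?_).mono le_rfl
    fun s h => h.2
  · obtain ⟨r0, r2, r3, r4⟩ := hr
    refine ⟨⟨by simpa, by simpa, by simpa, by simpa⟩, hi, ?_, ?_⟩
    · simp [h0]
    · intro t ht i; exact ⟨h0 t (by omega) i, h0 3 le_rfl i⟩
  · rintro k hk s h5 - ⟨⟨r0, r2, r3, r4⟩, ⟨a0, a1, a2⟩, h4, h0⟩
    refine Ends.of_wp ?_
    simp only [markFirst, Prog.wp, Test.Holds, Mem.setReg_reg, Mem.setReg_arr, Mem.setArr_reg, h5, r3, r2]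
    refine ⟨fun hc => ?_, fun hc => ?_⟩
    · simp [a0] at hc
      refine ⟨by simp, by simp [r0], ⟨by simp [r0], by simp [r2], by simp [r3], by simp [r4]⟩,
        ⟨a0, a1, a2⟩, ?_, h0⟩
      intro b
      simp only [h4]
      refine ⟨fun h a ha hl => ?_, fun h a ha => h a (by omega)⟩
      by_cases hak : a = k
      · subst hak; exact absurd hc hl
      · exact h a (by omega) hl
    · simp [a0] at hc
      refine ⟨by simp, by simp [r0], ⟨by simp [r0], by simp [r2], by simp [r3], by simp [r4]⟩,
        ⟨by simpa, by simpa, by simpa⟩, ?_, ?_⟩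
      · intro b
        simp [a1]
        grind
      · intro t ht i
        have : t ≠ 4 := by omega
        simpa [this] using h0 t ht i

/-- Only the cells of items listed by hard persons receive labels, so the time does not depend on
the number of items. -/
theorem ends_initPerson {s : Mem} (hr : I.Regs s) (hi : I.Input s.arr)
    (h4 : ∀ b, s.arr 4 b = 0 ↔ ∀ a < I.n, I.listLength a ≠ 0 → I.choice 0 a ≠ b)
    (h0 : ∀ t ≥ 5, ∀ i, s.arr t i = 0 ∧ s.arr 3 i = 0) :
    Ends I.costArray (.loop 5 0 initPerson) s (I.n * (initPerson.time + 2) + 2) fun s =>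
      I.Regs s ∧ I.Input s.arr ∧ (∀ i, s.arr 3 i = 0) ∧ (∀ i, s.arr 8 i = 0) ∧
      (∀ a, I.HardNat a → s.arr 5 a = I.cheaperNat a ∧ s.arr 7 (I.choice 0 a) = I.choice 0 a ∧
        s.arr 7 (I.choice 1 a) = I.choice 1 a) ∧
      ∀ a, s.arr 6 a = 1 ↔ I.HardNat a := by
  refine (Ends.loop (n := I.n) (Inv := fun k s => I.Regs s ∧ I.Input s.arr ∧
      (∀ b, s.arr 4 b = 0 ↔ ∀ a < I.n, I.listLength a ≠ 0 → I.choice 0 a ≠ b) ∧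
      (∀ i, s.arr 3 i = 0) ∧ (∀ i, s.arr 8 i = 0) ∧
      (∀ a < k, I.HardNat a → s.arr 5 a = I.cheaperNat a ∧ s.arr 7 (I.choice 0 a) = I.choice 0 a ∧
        s.arr 7 (I.choice 1 a) = I.choice 1 a) ∧
      ∀ a, s.arr 6 a = 1 ↔ a < k ∧ I.HardNat a) (by decide) hr.r0 ?_ ?_).mono le_rfl ?_
  · obtain ⟨r0, r2, r3, r4⟩ := hr
    refine ⟨⟨by simpa, by simpa, by simpa, by simpa⟩, hi, h4, fun i => (h0 5 le_rfl i).2,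
      fun i => (h0 8 (by omega) i).1, by simp, fun a => ?_⟩
    simp [(h0 6 (by omega) a).1]
  · rintro k hk s h5 - ⟨⟨r0, r2, r3, r4⟩, ⟨a0, a1, a2⟩, h4, z3, z8, hlab, hst⟩
    refine Ends.of_wp ?_
    have hno : ¬ I.HardNat k → (∀ a < k + 1, I.HardNat a → s.arr 5 a = I.cheaperNat a ∧
        s.arr 7 (I.choice 0 a) = I.choice 0 a ∧ s.arr 7 (I.choice 1 a) = I.choice 1 a) ∧
        ∀ a, s.arr 6 a = 1 ↔ a < k + 1 ∧ I.HardNat a := by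
      intro hn
      refine ⟨fun a ha hh => hlab a ?_ hh, fun a => ?_⟩
      · have : a ≠ k := by rintro rfl; exact hn hh
        omega
      · rw [hst]
        refine ⟨fun h => ⟨by omega, h.2⟩, fun h => ⟨?_, h.2⟩⟩
        have : a ≠ k := by rintro rfl; exact hn h.2
        omega
    have hyes : ∀ s' : Mem, I.Regs s' → I.HardNat k →
        (∀ t i, s'.arr t i = if t = 5 ∧ i = k then I.cheaperNat k else if t = 6 ∧ i = k then 1 else
          if t = 7 ∧ (i = I.choice 0 k ∨ i = I.choice 1 k) then i else s.arr t i) →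
        I.Regs (s'.setReg 5 (k + 1)) ∧ I.Input s'.arr ∧
        (∀ b, s'.arr 4 b = 0 ↔ ∀ a < I.n, I.listLength a ≠ 0 → I.choice 0 a ≠ b) ∧
        (∀ i, s'.arr 3 i = 0) ∧ (∀ i, s'.arr 8 i = 0) ∧
        (∀ a < k + 1, I.HardNat a → s'.arr 5 a = I.cheaperNat a ∧
          s'.arr 7 (I.choice 0 a) = I.choice 0 a ∧ s'.arr 7 (I.choice 1 a) = I.choice 1 a) ∧
        ∀ a, s'.arr 6 a = 1 ↔ a < k + 1 ∧ I.HardNat a := by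
      rintro s' ⟨r0, r2, r3, r4⟩ hh harr
      refine ⟨⟨by simpa, by simpa, by simpa, by simpa⟩,
        ⟨by simpa [harr], by simpa [harr], by simpa [harr]⟩, by simpa [harr], by simpa [harr],
        by simpa [harr], fun a ha hha => ?_, fun a => ?_⟩
      · by_cases hak : a = k
        · subst hak; simp [harr]
        · have := hlab a (by omega) hha
          simp only [harr]
          grind
      · have := hst a
        simp only [harr]
        grind
    simp only [initPerson, Prog.wp, Test.Holds, Mem.setReg_reg, Mem.setReg_arr, Mem.setArr_reg, h5,
      r3, r2, r4, a0, a1, a2, if_true, if_false, Nat.reduceEqDiff]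
    refine ⟨fun hl => ⟨fun hf => ⟨fun hc => ?_, fun hc => ?_⟩, fun hf => ?_⟩, fun hl => ?_⟩
    · have hh : I.HardNat k := ⟨hk, hl, (h4 _).1 hf⟩
      refine ⟨trivial, r0, hyes _ ⟨?_, ?_, ?_, ?_⟩ hh ?_⟩
      · simp [r0]
      · simp [r2]
      · simp [r3]
      · simp [r4]
      · intro t i
        have : I.cheaperNat k = I.choice 1 k := if_pos hc
        simp [this]
        grind
    · have hh : I.HardNat k := ⟨hk, hl, (h4 _).1 hf⟩
      refine ⟨trivial, r0, hyes _ ⟨?_, ?_, ?_, ?_⟩ hh ?_⟩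
      · simp [r0]
      · simp [r2]
      · simp [r3]
      · simp [r4]
      · intro t i
        have : I.cheaperNat k = I.choice 0 k := if_neg hc
        simp [this]
        grind
    · have hh : ¬ I.HardNat k := fun h => hf ((h4 _).2 h.2.2)
      exact ⟨by simp, by simp [r0], ⟨by simp [r0], by simp [r2], by simp [r3], by simp [r4]⟩,
        ⟨a0, a1, a2⟩, h4, z3, z8, hno hh⟩
    · have hh : ¬ I.HardNat k := fun h => hl h.2.1
      exact ⟨by simp, by simp [r0], ⟨by simp [r0], by simp [r2], by simp [r3], by simp [r4]⟩,
        ⟨a0, a1, a2⟩, h4, z3, z8, hno hh⟩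
  · rintro s ⟨-, hr, hi, -, z3, z8, h1, h2⟩
    exact ⟨hr, hi, z3, z8, fun a ha => h1 a ha.1 ha, fun a => (h2 a).trans ⟨fun h => h.2,
      fun h => ⟨h.1, h⟩⟩⟩

theorem choice_zero (a : I.HardPerson) : I.choice 0 a.1 = I.fst a := by
  simp [choice, pref_eq_of_hard]

theorem choice_one (a : I.HardPerson) : I.choice 1 a.1 = I.snd a := by
  simp [choice, pref_eq_of_hard]

theorem costArray_val (b : Fin I.m) : I.costArray b = I.cost b := by simp [costArray]

theorem cheaperNat_val (a : I.HardPerson) : I.cheaperNat a.1 = I.cheaper a := by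
  unfold cheaperNat cheaper
  rw [choice_zero, choice_one, costArray_val, costArray_val]
  split_ifs <;> rfl

theorem hardNat_iff {a : ℕ} : I.HardNat a ↔ ∃ h : I.HardPerson, h.1 = a := by
  constructor
  · rintro ⟨ha, hl, hf⟩
    have hl' : (I.pref ⟨a, ha⟩).length = 2 := by simpa [listLength, ha] using hl
    refine ⟨⟨⟨a, ha⟩, hl', ?_⟩, rfl⟩
    rintro ⟨c, hc⟩
    obtain ⟨u, v, hp⟩ := List.length_eq_two.1 hl'
    refine hf c c.2 ?_ ?_
    · simp only [listLength, c.2, dif_pos]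
      intro h0
      simp [List.length_eq_zero_iff.1 h0] at hc
    · have h1 : I.choice 1 a = v := by simp [choice, ha, hp]
      have h2 : (I.pref c).head? = some v := by simpa [hp] using hc
      rw [h1]
      rw [List.head?_eq_getElem?] at h2
      simp [choice, h2]
  · rintro ⟨h, rfl⟩
    refine ⟨h.1.2, by simp [listLength, pref_eq_of_hard], fun c hc hl he => ?_⟩
    rw [choice_one] at he
    refine not_isFirst_snd h ⟨⟨c, hc⟩, ?_⟩
    cases hp : I.pref ⟨c, hc⟩ with
    | nil => simp [listLength, hc, hp] at hl
    | cons u l =>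
      simp only [choice, hc, hp, dif_pos, List.getElem?_cons_zero, Option.map_some,
        Option.getD_some] at he
      rw [List.head?_cons, Fin.ext he]

theorem cheaper_eq (a : I.HardPerson) : I.cheaper a = I.fst a ∨ I.cheaper a = I.snd a := by
  unfold cheaper; split_ifs <;> simp

theorem cost_cheaper_le_fst (a : I.HardPerson) : I.cost (I.cheaper a) ≤ I.cost (I.fst a) := by
  unfold cheaper; split_ifs with h
  exacts [h.le, le_rfl]

theorem cost_cheaper_le_snd (a : I.HardPerson) : I.cost (I.cheaper a) ≤ I.cost (I.snd a) := by
  unfold cheaper; split_ifs with h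
  exacts [le_rfl, not_lt.1 h]

/-- The contents of the arrays when the hard persons in `A` are accepted and those in `B` are
rejected. -/
structure State (A B : Finset I.HardPerson) (arr : ℕ → ℕ → ℕ) : Prop where
  input : I.Input arr
  cheaper : ∀ a : I.HardPerson, arr 5 a.1 = I.cheaper a
  status : ∀ a, arr 6 a = 1 ↔ ∃ h : I.HardPerson, h.1 = a ∧ h ∉ A ∪ B
  kruskal : KruskalInv I.fst I.snd I.cheaper I.cost A B (fun b => arr 7 b) (fun l => arr 8 l = 1)
    (fun b => arr 3 b)

theorem Regs.setReg {s : Mem} (h : I.Regs s) {i v : ℕ} (hi : 5 ≤ i) : I.Regs (s.setReg i v) := by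
  obtain ⟨r0, r2, r3, r4⟩ := h
  constructor <;> rw [Mem.setReg_reg, if_neg (by omega)] <;> assumption

theorem Regs.setArr {s : Mem} (h : I.Regs s) {t i v : ℕ} : I.Regs (s.setArr t i v) :=
  ⟨h.r0, h.r2, h.r3, h.r4⟩

/-- Register 10 holds the unprocessed person whose cheaper item costs most, if there is one. -/
def Best (A B : Finset I.HardPerson) (k : ℕ) (s : Mem) : Prop :=
  (s.reg 9 = 0 ∧ ∀ h : I.HardPerson, h ∉ A ∪ B → ¬ h.1.1 < k) ∨
  (s.reg 9 = 1 ∧ ∃ h : I.HardPerson, h.1 = s.reg 10 ∧ h ∉ A ∪ B ∧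
    ∀ h' : I.HardPerson, h' ∉ A ∪ B → h'.1.1 < k → I.cost (I.cheaper h') ≤ I.cost (I.cheaper h))

theorem ends_scan {A B : Finset I.HardPerson} {s : Mem} {r : ℕ} (hr : I.Regs s)
    (h6 : s.reg 6 = r) (h9 : s.reg 9 = 0) (hs : State A B s.arr) :
    Ends I.costArray (.loop 5 0 scanPerson) s (I.n * (scanPerson.time + 2) + 2) fun s =>
      I.Regs s ∧ s.reg 6 = r ∧ State A B s.arr ∧ Best A B I.n s := by
  refine (Ends.loop (n := I.n) (Inv := fun k s => I.Regs s ∧ s.reg 6 = r ∧ State A B s.arr ∧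
      Best A B k s) (by decide) hr.r0 ?_ ?_).mono le_rfl fun s h => h.2
  · exact ⟨hr.setReg le_rfl, by simpa using h6, hs, .inl (by simp [h9])⟩
  · rintro k hk s h5 h0 ⟨hr, h6, hs, hbest⟩
    refine Ends.of_wp ?_
    simp only [scanPerson, Prog.wp, Test.Holds, Mem.setReg_reg, Mem.setReg_arr, h5, hr.r3, hr.r2,
      Nat.reduceEqDiff, if_false, if_true]
    have hlt : ∀ h : I.HardPerson, h.1.1 < k + 1 → h.1.1 = k ∨ h.1.1 < k := fun h hh => by omega
    refine ⟨fun hc => ⟨fun h9 => ?_, fun h9 => ⟨fun hlt' => ?_, fun hle => ?_⟩⟩, fun hc => ?_⟩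
    · obtain ⟨h, hh, hn⟩ := (hs.status k).1 hc
      refine ⟨trivial, h0, ((hr.setReg (by decide)).setReg (by decide)).setReg (by decide)
        |>.setReg le_rfl, by simpa using h6, hs, .inr ⟨by simp, h, by simp [hh], hn, ?_⟩⟩
      intro h' hn' hk'
      rcases hlt h' hk' with e | e
      · rw [Subtype.ext (Fin.ext (e.trans hh.symm))]
      · rcases hbest with hb | hb
        · exact absurd e (hb.2 h' hn')
        · omega
    · obtain ⟨h, hh, hn⟩ := (hs.status k).1 hc
      rcases hbest with hb | ⟨hb, g, hg, hgn, hgm⟩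
      · exact absurd hb.1 h9
      rw [← hh, ← hg, hs.cheaper, hs.cheaper, costArray_val, costArray_val] at hlt'
      refine ⟨trivial, h0, ((hr.setReg (by decide)).setReg (by decide)).setReg (by decide)
        |>.setReg (by decide) |>.setReg le_rfl, by simpa using h6, hs,
        .inr ⟨by simpa using hb, h, by simp [hh], hn, ?_⟩⟩
      intro h' hn' hk'
      rcases hlt h' hk' with e | e
      · rw [Subtype.ext (Fin.ext (e.trans hh.symm))]
      · exact (hgm h' hn' e).trans hlt'.le
    · obtain ⟨h, hh, hn⟩ := (hs.status k).1 hc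
      rcases hbest with hb | ⟨hb, g, hg, hgn, hgm⟩
      · exact absurd hb.1 h9
      rw [← hh, ← hg, hs.cheaper, hs.cheaper, costArray_val, costArray_val] at hle
      refine ⟨trivial, h0, ((hr.setReg (by decide)).setReg (by decide)).setReg (by decide)
        |>.setReg (by decide) |>.setReg le_rfl, by simpa using h6, hs,
        .inr ⟨by simpa using hb, g, by simpa using hg, hgn, ?_⟩⟩
      intro h' hn' hk'
      rcases hlt h' hk' with e | e
      · rw [Subtype.ext (Fin.ext (e.trans hh.symm))]
        exact not_lt.1 hle
      · exact hgm h' hn' e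
    · refine ⟨trivial, h0, ((hr.setReg (by decide)).setReg (by decide)).setReg le_rfl,
        by simpa using h6, hs, ?_⟩
      have hne : ∀ h : I.HardPerson, h ∉ A ∪ B → h.1.1 < k + 1 → h.1.1 < k := fun h hn hk' =>
        (hlt h hk').resolve_left fun e => hc ((hs.status k).2 ⟨h, e, hn⟩)
      rcases hbest with hb | ⟨hb, g, hg, hgn, hgm⟩
      · exact .inl ⟨by simpa using hb.1, fun h hn hk' => hb.2 h hn (hne h hn hk')⟩
      · exact .inr ⟨by simpa using hb, g, by simpa using hg, hgn,
          fun h' hn' hk' => hgm h' hn' (hne h' hn' hk')⟩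

theorem wp_relabelPerson {cost : ℕ → ℝ} {Q : Mem → Prop} {s : Mem} {k c d p q : ℕ}
    (h5 : s.reg 5 = k) (h11 : s.reg 11 = p) (h12 : s.reg 12 = q) (a1 : s.arr 1 k = c)
    (a2 : s.arr 2 k = d)
    (hQ : ∀ s', (∀ i, i ≠ 7 → i ≠ 15 → s'.reg i = s.reg i) → (∀ t, t ≠ 7 → s'.arr t = s.arr t) →
      (∀ b, s'.arr 7 b = if (b = c ∨ b = d) ∧ s.arr 7 b = p then q else s.arr 7 b) → Q s') :
    relabelPerson.wp cost Q s := by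
  simp only [relabelPerson, Prog.wp, Test.Holds, Mem.setReg_reg, Mem.setReg_arr, Mem.setArr_reg,
    Mem.setArr_arr, h5, h11, h12, a1, a2, Nat.reduceEqDiff, if_false, if_true]
  refine ⟨fun h1 => ⟨fun h2 => ?_, fun h2 => ?_⟩, fun h1 => ⟨fun h2 => ?_, fun h2 => ?_⟩⟩ <;>
  · refine hQ _ (fun i hi hi' => by simp [hi, hi']) (fun t ht => ?_) fun b => ?_
    · funext j
      simp [ht]
    · simp
      grind

/-- The effect of merging the labels `p` and `q`. -/
theorem ends_relabel {s : Mem} {r p q : ℕ} (hr : I.Regs s) (hi : I.Input s.arr)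
    (h6 : s.reg 6 = r) (h11 : s.reg 11 = p) (h12 : s.reg 12 = q) :
    Ends I.costArray (.loop 5 0 relabelPerson) s (I.n * (relabelPerson.time + 2) + 2) fun s' =>
      I.Regs s' ∧ s'.reg 6 = r ∧ (∀ t, t ≠ 7 → s'.arr t = s.arr t) ∧
      ∀ h : I.HardPerson, ∀ b : Fin I.m, b = I.fst h ∨ b = I.snd h →
        s'.arr 7 b = if s.arr 7 b = p then q else s.arr 7 b := by
  -- A cell is either final or still untouched, and in the latter case it belongs to no person seen
  -- so far. Repeated visits and the default item `0` do no harm, because only the label `p` is ever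
  -- replaced, and always by `q`.
  refine (Ends.loop (n := I.n) (Inv := fun k s' => I.Regs s' ∧ s'.reg 6 = r ∧ s'.reg 11 = p ∧
      s'.reg 12 = q ∧ (∀ t, t ≠ 7 → s'.arr t = s.arr t) ∧
      ∀ b, s'.arr 7 b = (if s.arr 7 b = p then q else s.arr 7 b) ∨
        s'.arr 7 b = s.arr 7 b ∧ ∀ a < k, b ≠ I.choice 0 a ∧ b ≠ I.choice 1 a)
      (by decide) hr.r0 ?_ ?_).mono le_rfl ?_
  · exact ⟨hr.setReg le_rfl, by simpa using h6, by simpa using h11, by simpa using h12,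
      fun _ _ => rfl, fun b => .inr ⟨rfl, by simp⟩⟩
  · rintro k hk s' h5 h0 ⟨hr, h6, h11, h12, ht, h7⟩
    refine Ends.of_wp ?_
    have a1 : s'.arr 1 k = I.choice 0 k := by rw [ht 1 (by decide), hi.a1]
    have a2 : s'.arr 2 k = I.choice 1 k := by rw [ht 2 (by decide), hi.a2]
    have hfin : ∀ s'' : Mem, I.Regs s'' → s''.reg 5 = k → s''.reg 6 = r → s''.reg 11 = p →
        s''.reg 12 = q → (∀ t, t ≠ 7 → s''.arr t = s'.arr t) →
        (∀ b, s''.arr 7 b = if (b = I.choice 0 k ∨ b = I.choice 1 k) ∧ s'.arr 7 b = p then q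
          else s'.arr 7 b) →
        s''.reg 5 = k ∧ s''.reg 0 = I.n ∧ I.Regs (s''.setReg 5 (k + 1)) ∧
        (s''.setReg 5 (k + 1)).reg 6 = r ∧ (s''.setReg 5 (k + 1)).reg 11 = p ∧
        (s''.setReg 5 (k + 1)).reg 12 = q ∧
        (∀ t, t ≠ 7 → (s''.setReg 5 (k + 1)).arr t = s.arr t) ∧
        ∀ b, (s''.setReg 5 (k + 1)).arr 7 b = (if s.arr 7 b = p then q else s.arr 7 b) ∨
          (s''.setReg 5 (k + 1)).arr 7 b = s.arr 7 b ∧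
            ∀ a < k + 1, b ≠ I.choice 0 a ∧ b ≠ I.choice 1 a := by
      intro s'' hr h5 h6 h11 h12 ht' h7'
      refine ⟨h5, hr.r0, hr.setReg le_rfl, by simpa using h6, by simpa using h11,
        by simpa using h12, fun t h => (ht' t h).trans (ht t h), fun b => ?_⟩
      have := h7' b
      simp only [Mem.setReg_arr]
      rcases h7 b with h | ⟨h, h'⟩
      · left; grind
      · by_cases hb : b = I.choice 0 k ∨ b = I.choice 1 k
        · left; grind
        · right
          refine ⟨by grind, fun a ha => ?_⟩
          by_cases hak : a = k
          · subst hak; grind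
          · exact h' a (by omega)
    refine wp_relabelPerson (p := p) (q := q) (h5 := h5) h11 h12 a1 a2 fun s'' hr' ht' h7' => ?_
    have hR : I.Regs s'' := ⟨by rw [hr' 0 (by decide) (by decide), hr.r0],
      by rw [hr' 2 (by decide) (by decide), hr.r2], by rw [hr' 3 (by decide) (by decide), hr.r3],
      by rw [hr' 4 (by decide) (by decide), hr.r4]⟩
    exact hfin s'' hR (by rw [hr' 5 (by decide) (by decide), h5])
      (by rw [hr' 6 (by decide) (by decide), h6]) (by rw [hr' 11 (by decide) (by decide), h11])
      (by rw [hr' 12 (by decide) (by decide), h12]) ht' h7'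
  · rintro s' ⟨-, hr, h6, -, -, ht, h7⟩
    refine ⟨hr, h6, ht, fun h b hb => ?_⟩
    rcases h7 b with h7 | ⟨-, h7⟩
    · exact h7
    · have := h7 h.1 h.1.2
      rw [choice_zero, choice_one] at this
      rcases hb with rfl | rfl
      · exact absurd rfl this.1
      · exact absurd rfl this.2

end Instance

end PopAug

namespace PopAug
namespace Instance
variable {I : Instance}

theorem wp_fetchLabels {cost : ℕ → ℝ} {Q : Mem → Prop} {s : Mem} {a b c : ℕ} (h3 : s.reg 3 = 0)
    (h10 : s.reg 10 = a) (a1 : s.arr 1 a = b) (a2 : s.arr 2 a = c)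
    (hQ : ∀ s', (∀ i < 11, s'.reg i = s.reg i) → s'.reg 11 = s.arr 7 b → s'.reg 12 = s.arr 7 c →
      s'.reg 13 = s.arr 8 (s.arr 7 b) → s'.reg 14 = s.arr 8 (s.arr 7 c) →
      (∀ t, t ≠ 6 → s'.arr t = s.arr t) → (∀ i, s'.arr 6 i = if i = a then 0 else s.arr 6 i) →
      Q s') : fetchLabels.wp cost Q s := by
  simp only [fetchLabels, Prog.wp, Mem.setReg_reg, Mem.setReg_arr, Mem.setArr_reg,
    Mem.setArr_arr, h3, h10, a1, a2, Nat.reduceEqDiff, if_false, if_true]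
  refine hQ _ (fun i hi => ?_) ?_ ?_ ?_ ?_ (fun t ht => ?_) fun i => ?_
  · have : i ≠ 11 ∧ i ≠ 12 ∧ i ≠ 13 ∧ i ≠ 14 ∧ i ≠ 15 ∧ i ≠ 16 := by omega
    simp [this]
  · simp
  · simp
  · simp
  · simp
  · funext j
    simp [ht]
  · simp

theorem wp_setFull {cost : ℕ → ℝ} {Q : Mem → Prop} {s : Mem} {p q : ℕ} (h2 : s.reg 2 = 1)
    (h11 : s.reg 11 = p) (h12 : s.reg 12 = q)
    (hQ : ∀ s', (∀ i, i ≠ 7 → s'.reg i = s.reg i) → (∀ t, t ≠ 8 → s'.arr t = s.arr t) →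
      (∀ l, s'.arr 8 l = 1 ↔ s.arr 8 l = 1 ∨ l = q ∧ (p = q ∨ s.reg 13 = 1)) → Q s') :
    setFull.wp cost Q s := by
  simp only [setFull, Prog.wp, Test.Holds, h11, h12, h2]
  refine ⟨fun h => ?_, fun h => ⟨fun h' => ?_, fun h' => ?_⟩⟩ <;>
  · refine hQ _ (fun i hi => by simp [hi]) (fun t ht => ?_) fun l => ?_
    · funext j
      simp [ht]
    · simp
      grind

theorem ends_accept {A B : Finset I.HardPerson} {s : Mem} {r : ℕ} {arr : ℕ → ℕ → ℕ}
    (hs : State A B arr) (a : I.HardPerson) (ha : a ∉ A ∪ B)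
    (hmax : ∀ c ∉ A ∪ B, I.cost (I.cheaper c) ≤ I.cost (I.cheaper a))
    (hr : I.Regs s) (h6 : s.reg 6 = r) (h11 : s.reg 11 = arr 7 (I.fst a))
    (h12 : s.reg 12 = arr 7 (I.snd a)) (h13 : s.reg 13 = arr 8 (arr 7 (I.fst a)))
    (harr : ∀ t, t ≠ 6 → s.arr t = arr t)
    (hst : ∀ i, s.arr 6 i = if i = a.1 then 0 else arr 6 i)
    (hnf : ¬ (arr 8 (arr 7 (I.fst a)) = 1 ∧ arr 8 (arr 7 (I.snd a)) = 1)) :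
    Ends I.costArray accept s (setFull.time + (I.n * (relabelPerson.time + 2) + 2)) fun s' =>
      I.Regs s' ∧ s'.reg 6 = r ∧ State (insert a A) B s'.arr := by
  refine Ends.seq (Q := fun s' => I.Regs s' ∧ s'.reg 6 = r ∧ s'.reg 11 = arr 7 (I.fst a) ∧
    s'.reg 12 = arr 7 (I.snd a) ∧ (∀ t, t ≠ 8 → s'.arr t = s.arr t) ∧
    ∀ l, s'.arr 8 l = 1 ↔ arr 8 l = 1 ∨ l = arr 7 (I.snd a) ∧
      (arr 7 (I.fst a) = arr 7 (I.snd a) ∨ arr 8 (arr 7 (I.fst a)) = 1)) (Ends.of_wp ?_) ?_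
  · refine wp_setFull hr.r2 h11 h12 fun s' h1 h2 h3 => ?_
    refine ⟨⟨?_, ?_, ?_, ?_⟩, ?_, ?_, ?_, h2, fun l => ?_⟩
    · rw [h1 0 (by decide), hr.r0]
    · rw [h1 2 (by decide), hr.r2]
    · rw [h1 3 (by decide), hr.r3]
    · rw [h1 4 (by decide), hr.r4]
    · rw [h1 6 (by decide), h6]
    · rw [h1 11 (by decide), h11]
    · rw [h1 12 (by decide), h12]
    · rw [h3, h13, harr 8 (by decide)]
  · rintro s' ⟨hr', h6', h11', h12', harr', h8⟩
    have hi : I.Input s'.arr := by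
      refine ⟨fun c => ?_, fun c => ?_, fun c => ?_⟩
      · rw [harr' 0 (by decide), harr 0 (by decide), hs.input.a0]
      · rw [harr' 1 (by decide), harr 1 (by decide), hs.input.a1]
      · rw [harr' 2 (by decide), harr 2 (by decide), hs.input.a2]
    refine (ends_relabel hr' hi h6' h11' h12').mono le_rfl ?_
    rintro s'' ⟨hr'', h6'', ht, h7⟩
    have hold : ∀ t, t ≠ 6 → t ≠ 7 → t ≠ 8 → s''.arr t = arr t := fun t e6 e7 e8 => by
      rw [ht t e7, harr' t e8, harr t e6]
    refine ⟨hr'', h6'', ?_, ?_, ?_, ?_⟩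
    · refine ⟨fun c => ?_, fun c => ?_, fun c => ?_⟩
      · rw [hold 0 (by decide) (by decide) (by decide), hs.input.a0]
      · rw [hold 1 (by decide) (by decide) (by decide), hs.input.a1]
      · rw [hold 2 (by decide) (by decide) (by decide), hs.input.a2]
    · intro c
      rw [hold 5 (by decide) (by decide) (by decide), hs.cheaper]
    · intro c
      rw [ht 6 (by decide), harr' 6 (by decide), hst]
      have h1 := hs.status c
      rw [Finset.insert_union]
      constructor
      · intro h
        split_ifs at h with hc
        obtain ⟨g, hg, hgn⟩ := h1.1 h
        refine ⟨g, hg, fun hgi => ?_⟩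
        rcases Finset.mem_insert.1 hgi with rfl | hgi
        exacts [hc hg.symm, hgn hgi]
      · rintro ⟨g, rfl, hgn⟩
        rw [Finset.mem_insert, not_or] at hgn
        rw [if_neg fun e => hgn.1 (Subtype.ext (Fin.ext e))]
        exact h1.2 ⟨g, rfl, hgn.2⟩
    · refine hs.kruskal.accept ha hmax hnf ?_ ?_ ?_
      · rintro b ⟨h, hb⟩
        rw [h7 h b hb, harr' 7 (by decide), harr 7 (by decide)]
      · intro l
        rw [ht 8 (by decide), h8]
      · intro b
        rw [hold 3 (by decide) (by decide) (by decide)]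

theorem ends_reject {A B : Finset I.HardPerson} {s : Mem} {r : ℕ} {arr : ℕ → ℕ → ℕ}
    (hs : State A B arr) (a : I.HardPerson) (ha : a ∉ A ∪ B)
    (hmax : ∀ c ∉ A ∪ B, I.cost (I.cheaper c) ≤ I.cost (I.cheaper a))
    (hr : I.Regs s) (h6 : s.reg 6 = r) (h10 : s.reg 10 = a.1)
    (harr : ∀ t, t ≠ 6 → s.arr t = arr t)
    (hst : ∀ i, s.arr 6 i = if i = a.1 then 0 else arr 6 i)
    (hf : arr 8 (arr 7 (I.fst a)) = 1 ∧ arr 8 (arr 7 (I.snd a)) = 1) :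
    Ends I.costArray reject s reject.time fun s' =>
      I.Regs s' ∧ s'.reg 6 = r ∧ State A (insert a B) s'.arr := by
  refine Ends.of_wp ?_
  simp only [reject, Prog.wp, Mem.setReg_reg, Mem.setReg_arr, h10, Nat.reduceEqDiff, if_false,
    if_true, harr 5 (by decide), harr 3 (by decide), hs.cheaper]
  refine ⟨((hr.setReg (by decide)).setReg (by decide)).setReg (by decide) |>.setArr,
    by simpa using h6, ⟨?_, ?_, ?_⟩, ?_, ?_, ?_⟩
  · simp [harr, hs.input.a0]
  · simp [harr, hs.input.a1]
  · simp [harr, hs.input.a2]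
  · simp [harr, hs.cheaper]
  · intro c
    simp only [Mem.setArr_arr, Nat.reduceEqDiff, if_false, Mem.setReg_arr, hst]
    have h1 := hs.status c
    rw [Finset.union_insert]
    constructor
    · intro h
      split_ifs at h with hc
      obtain ⟨g, hg, hgn⟩ := h1.1 h
      refine ⟨g, hg, fun hgi => ?_⟩
      rcases Finset.mem_insert.1 hgi with rfl | hgi
      exacts [hc hg.symm, hgn hgi]
    · rintro ⟨g, rfl, hgn⟩
      rw [Finset.mem_insert, not_or] at hgn
      rw [if_neg fun e => hgn.1 (Subtype.ext (Fin.ext e))]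
      exact h1.2 ⟨g, rfl, hgn.2⟩
  · have h8 : (fun l => ((((s.setReg 7 (I.cheaper a)).setReg 8 (arr 3 (I.cheaper a))).setReg 8
        (arr 3 (I.cheaper a) + 1)).setArr 3 (I.cheaper a) (arr 3 (I.cheaper a) + 1)).arr 8 l = 1) =
        fun l => arr 8 l = 1 := by
      funext l; simp [harr]
    rw [h8]
    refine hs.kruskal.reject cheaper_eq cost_cheaper_le_fst cost_cheaper_le_snd ha hmax hf.1 hf.2
      (fun b => by simp [harr]) fun b => ?_
    by_cases hb : b = I.cheaper a
    · subst hb; simp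
    · simp [hb, Fin.val_inj, harr]

theorem ends_process {A B : Finset I.HardPerson} {s : Mem} {r : ℕ} (hs : State A B s.arr)
    (a : I.HardPerson) (ha : a ∉ A ∪ B)
    (hmax : ∀ c ∉ A ∪ B, I.cost (I.cheaper c) ≤ I.cost (I.cheaper a))
    (hr : I.Regs s) (h6 : s.reg 6 = r) (h10 : s.reg 10 = a.1) :
    Ends I.costArray process s
      (fetchLabels.time + (reject.time + (setFull.time + (I.n * (relabelPerson.time + 2) + 2)) + 1 + 1))
      fun s' => I.Regs s' ∧ s'.reg 6 = r ∧ ∃ A' B' : Finset I.HardPerson, State A' B' s'.arr ∧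
        A' ∪ B' = insert a (A ∪ B) := by
  refine Ends.seq (Q := fun s' => I.Regs s' ∧ s'.reg 6 = r ∧ s'.reg 10 = a.1 ∧
    s'.reg 11 = s.arr 7 (I.fst a) ∧ s'.reg 12 = s.arr 7 (I.snd a) ∧
    s'.reg 13 = s.arr 8 (s.arr 7 (I.fst a)) ∧ s'.reg 14 = s.arr 8 (s.arr 7 (I.snd a)) ∧
    (∀ t, t ≠ 6 → s'.arr t = s.arr t) ∧ (∀ i, s'.arr 6 i = if i = a.1 then 0 else s.arr 6 i))
    (Ends.of_wp ?_) ?_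
  · refine wp_fetchLabels hr.r3 h10 ((hs.input.a1 _).trans (choice_zero a))
      ((hs.input.a2 _).trans (choice_one a)) fun s' h1 h2 h3 h4 h5 h6' h7 => ?_
    refine ⟨⟨?_, ?_, ?_, ?_⟩, ?_, ?_, h2, h3, h4, h5, h6', h7⟩
    · rw [h1 0 (by decide), hr.r0]
    · rw [h1 2 (by decide), hr.r2]
    · rw [h1 3 (by decide), hr.r3]
    · rw [h1 4 (by decide), hr.r4]
    · rw [h1 6 (by decide), h6]
    · rw [h1 10 (by decide), h10]
  · rintro s' ⟨hr', h6', h10', h11, h12, h13, h14, harr, hst⟩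
    have hacc := fun hnf => (ends_accept hs a ha hmax hr' h6' h11 h12 h13 harr hst hnf).mono
      (Q' := fun s' => I.Regs s' ∧ s'.reg 6 = r ∧ ∃ A' B' : Finset I.HardPerson, State A' B' s'.arr ∧
        A' ∪ B' = insert a (A ∪ B)) le_rfl
      fun s'' h => ⟨h.1, h.2.1, _, _, h.2.2, Finset.insert_union _ _ _⟩
    refine Ends.ite (fun h1 => Ends.ite (fun h2 => ?_) fun h2 => ?_) fun h1 => ?_
    · refine (ends_reject hs a ha hmax hr' h6' h10' harr hst ?_).mono (by omega)
        fun s'' h => ⟨h.1, h.2.1, _, _, h.2.2, Finset.union_insert _ _ _⟩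
      simp only [Test.Holds, h13, h14, hr'.r2] at h1 h2
      exact ⟨h1, h2⟩
    · refine (hacc fun hf => h2 ?_).mono (by omega) fun _ => id
      simp only [Test.Holds, h14, hr'.r2]
      exact hf.2
    · refine (hacc fun hf => h1 ?_).mono (by omega) fun _ => id
      simp only [Test.Holds, h13, hr'.r2]
      exact hf.1

/-- A bound for the running time of one round. -/
def roundTime (n : ℕ) : ℕ :=
  1 + ((n * (scanPerson.time + 2) + 2) + (fetchLabels.time +
    (reject.time + (setFull.time + (n * (relabelPerson.time + 2) + 2)) + 1 + 1) + 1))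

theorem ends_round {A B : Finset I.HardPerson} {s : Mem} {r : ℕ} (hs : State A B s.arr)
    (hr : I.Regs s) (h6 : s.reg 6 = r) :
    Ends I.costArray round s (roundTime I.n) fun s' => I.Regs s' ∧ s'.reg 6 = r ∧
      ∃ A' B' : Finset I.HardPerson, State A' B' s'.arr ∧ (A' ∪ B' = Finset.univ ∨ (A ∪ B).card < (A' ∪ B').card) := by
  refine Ends.seq (Ends.of_wp (Q := fun s' => I.Regs s' ∧ s'.reg 6 = r ∧ s'.reg 9 = 0 ∧
    State A B s'.arr) ⟨hr.setReg (by decide), by simpa using h6, by simp, hs⟩) ?_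
  rintro s1 ⟨hr1, h61, h91, hs1⟩
  refine Ends.seq (ends_scan hr1 h61 h91 hs1) ?_
  rintro s2 ⟨hr2, h62, hs2, hbest⟩
  refine Ends.ite (fun h => ?_) fun h => ?_
  · simp only [Test.Holds, hr2.r2] at h
    rcases hbest with hb | ⟨-, a, h10, ha, hmax⟩
    · omega
    · refine (ends_process hs2 a ha (fun c hc => hmax c hc c.1.2) hr2 h62 h10.symm).mono le_rfl ?_
      rintro s' ⟨hr', h6', A', B', hs', hAB⟩
      refine ⟨hr', h6', A', B', hs', .inr ?_⟩
      rw [hAB, Finset.card_insert_of_notMem ha]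
      omega
  · simp only [Test.Holds, hr2.r2] at h
    rcases hbest with hb | hb
    · refine (Ends.of_wp (p := .const 7 0) ?_).mono (by simp only [Prog.time]; omega) fun _ => id
      refine ⟨hr2.setReg (by decide), by simpa using h62, A, B, hs2, .inl ?_⟩
      refine Finset.eq_univ_iff_forall.2 fun c => ?_
      by_contra hc
      exact hb.2 c hc c.1.2
    · exact absurd hb.1 h

/-- Every round before completion processes one more hard person, and there are at most `n` of them;
further rounds leave all persons processed. -/
theorem ends_rounds {s : Mem} (hs : State (I := I) ∅ ∅ s.arr) (hr : I.Regs s) :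
    Ends I.costArray (.loop 6 0 round) s (I.n * (roundTime I.n + 2) + 2) fun s' =>
      ∃ A B : Finset I.HardPerson, State A B s'.arr ∧ A ∪ B = Finset.univ := by
  refine (Ends.loop (n := I.n) (Inv := fun k s => I.Regs s ∧ ∃ A B : Finset I.HardPerson, State A B s.arr ∧
    (A ∪ B = Finset.univ ∨ k ≤ (A ∪ B).card)) (by decide) hr.r0 ?_ ?_).mono le_rfl ?_
  · exact ⟨hr.setReg (by decide), ∅, ∅, hs, .inr (Nat.zero_le _)⟩
  · rintro k hk s h6 - ⟨hr, A, B, hs, hAB⟩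
    refine (ends_round hs hr h6).mono le_rfl ?_
    rintro s' ⟨hr', h6', A', B', hs', hAB'⟩
    refine ⟨h6', hr'.r0, hr'.setReg (by decide), A', B', hs', ?_⟩
    rcases hAB' with h | h
    · exact .inl h
    rcases hAB with h' | h'
    · rw [h'] at h
      exact absurd (Finset.card_le_univ (A' ∪ B')) (by rw [Finset.card_univ] at h; omega)
    · exact .inr (by omega)
  · rintro s' ⟨-, -, A, B, hs', h | h⟩
    · exact ⟨A, B, hs', h⟩
    · refine ⟨A, B, hs', (Finset.card_eq_iff_eq_univ _).1 (le_antisymm (Finset.card_le_univ _) ?_)⟩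
      refine le_trans ?_ h
      simpa using Fintype.card_le_of_injective (Subtype.val : I.HardPerson → Fin I.n)
        Subtype.val_injective

theorem ends_program (I : Instance) :
    Ends I.costArray program I.input (2 + ((I.n * (markFirst.time + 2) + 2) +
      ((I.n * (initPerson.time + 2) + 2) + (I.n * (roundTime I.n + 2) + 2)))) fun s =>
      Feas I.fst I.snd (I.output s) ∧ Certified I.fst I.snd I.cost (I.output s) := by
  refine Ends.seq (Ends.of_wp (p := .seq (.const 2 1) (.const 4 2)) (Q := fun s => I.Regs s ∧
    I.Input s.arr ∧ ∀ t ≥ 3, ∀ i, s.arr t i = 0) ?_) ?_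
  · refine ⟨⟨?_, ?_, ?_, ?_⟩, ⟨fun _ => rfl, fun _ => rfl, fun _ => rfl⟩, ?_⟩
    · simp [input]
    · simp
    · simp [input]
    · simp
    · intro t ht i
      match t, ht with
      | t + 3, _ => rfl
  rintro s1 ⟨hr1, hi1, h1⟩
  refine Ends.seq (ends_markFirst hr1 hi1 h1) ?_
  rintro s2 ⟨hr2, hi2, h4, h2⟩
  refine Ends.seq (ends_initPerson hr2 hi2 h4 h2) ?_
  rintro s3 ⟨hr3, hi3, z3, z8, hlab, hst⟩
  have hs : State (I := I) ∅ ∅ s3.arr := by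
    refine ⟨hi3, fun a => ?_, fun a => ?_, ?_⟩
    · rw [(hlab a.1 (hardNat_iff.2 ⟨a, rfl⟩)).1, cheaperNat_val]
    · rw [hst, hardNat_iff]
      simp
    · have h7 : ∀ b ∈ endpoints I.fst I.snd, s3.arr 7 b = b := by
        rintro b ⟨a, rfl | rfl⟩
        · rw [← choice_zero, (hlab a.1 (hardNat_iff.2 ⟨a, rfl⟩)).2.1]
        · rw [← choice_one, (hlab a.1 (hardNat_iff.2 ⟨a, rfl⟩)).2.2]
      refine KruskalInv.init (fun b hb c hc h => ?_) (fun l => by simp [z8]) fun b => z3 _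
      rw [h7 b hb, h7 c hc] at h
      exact Fin.ext h
  refine (ends_rounds hs hr3).mono le_rfl ?_
  rintro s4 ⟨A, B, hs4, hAB⟩
  exact ⟨hs4.kruskal.feas cheaper_eq hAB, hs4.kruskal.cert⟩

end Instance

end PopAug

theorem mainTheorem5 :
    -- the greedy algorithm: at most as many iterations as people, never stuck, correct
    (∀ I : PopAug.Instance, (∀ a, (I.pref a).length ≤ 2) →
      ∀ (k : ℕ) (x : Fin I.m → ℕ), I.GreedyReach k x →
        k ≤ I.n ∧
        (¬ I.Done x → ∃ y, I.GreedyStep x y) ∧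
        (I.Done x → I.IsMinCostAugmentation x)) ∧
    -- one program carries it out, and solves the problem, in quadratic time
    (∃ (P : PopAug.Prog) (C : ℕ), ∀ I : PopAug.Instance, (∀ a, (I.pref a).length ≤ 2) →
      ∃ (t : ℕ) (s : PopAug.Mem),
        PopAug.Run I.costArray P I.input t s ∧
        t ≤ C * (I.n ^ 2 + 1) ∧
        I.IsMinCostAugmentation (I.output s) ∧
        (∃ k, I.GreedyReach k (I.output s)) ∧ I.Done (I.output s)) := by
  refine ⟨fun I hl k x h => ⟨h.le hl, h.exists_step hl, h.isMinCostAugmentation hl⟩,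
    PopAug.program, 200, fun I hl => ?_⟩
  obtain ⟨t, s, hrun, ht, hf, hc⟩ := PopAug.Instance.ends_program I
  obtain ⟨k, hk, hd⟩ := PopAug.Instance.GreedyReach.of_certified hl hf hc
    PopAug.Instance.GreedyReach.start fun _ => Nat.zero_le _
  refine ⟨t, s, hrun, ht.trans ?_, hk.isMinCostAugmentation hl hd, ⟨k, hk⟩, hd⟩
  -- The bound of `ends_program` evaluates to `19 n² + 43 n + 8`, so the constant 200 is generous.
  have hn : I.n ≤ I.n ^ 2 := by nlinarith [Nat.zero_le I.n, Nat.le_self_pow two_ne_zero I.n]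
  simp only [PopAug.Instance.roundTime, PopAug.Prog.time, PopAug.markFirst, PopAug.initPerson,
    PopAug.scanPerson, PopAug.fetchLabels, PopAug.reject, PopAug.setFull, PopAug.relabelPerson]
  norm_num
  nlinarith
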